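/- Let $f(\cdot,\xi_1),\dots,f(\cdot,\xi_n):\mathbb R^d\to\mathbb R$ ($n\ge 1$) be the losses of $n$ data points, let $f(x)=\frac1n\sum_{i=1}^n f(x,\xi_i)$, and assume $f\ge 0$. For a minibatch $B$ of $b\ge 1$ data points let $f(x,B)$ be the average of their losses. LightSAM-I with perturbation radius $\rho>0$, learning rate $\eta>0$, $\epsilon>0$ and deterministic starting point $x_1$ sets $u_0=v_0=\epsilon^2$ and, for $t=1,2,\dots$, draws a minibatch $B_t$ and computes $$s_t=\nabla f(x_t,B_t),\quad u_t=u_{t-1}+\|s_t\|^2,\quad w_t=x_t+\rho\frac{s_t}{\sqrt{u_t}},\quad g_t=\nabla f(w_t,B_t),\quad v_t=v_{t-1}+\|g_t\|^2,\quad x_{t+1}=x_t-\eta\frac{g_t}{\sqrt{v_t}}.$$ The minibatches $B_1,B_2,\dots$ are independent, and each member of each minibatch is uniformly distributed on the data set (sampling with or without replacement inside a minibatch). Assume: (1) each $f(\cdot,\xi_i)$ is differentiable and $\|\nabla f(x,\xi_i)-\nabla f(y,\xi_i)\|\le L\|x-y\|$ for all $x,y$, where $L\ge 0$; (2) there are $D_0,D_1>0$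 with $\mathbb E\|\nabla f(x,B_t)\|^2\le D_0+D_1\|\nabla f(x)\|^2$ for all $x\in\mathbb R^d$ and all $t$. Put $\hat w_1=x_1+\rho\,\nabla f(x_1)/\sqrt{\epsilon^2+\|\nabla f(x_1)\|^2}$ and, for $T\in\mathbb N$, $$D_2=\max\Big\{1,\,4D_1,\,\frac{32(1+\sqrt{D_1})D_1\rho\sqrt{\rho L+\epsilon}}{\eta\sqrt\epsilon}\Big\},\qquad A_1=\frac{\|\nabla f(\hat w_1)\|^2}{\epsilon}+\frac{4(1+2D_2)L^2}{\epsilon}\big(\eta^2-4\rho^2\ln\epsilon\big),$$ $$A_2=2\rho^2L+\frac{\rho D_0}{2\epsilon\sqrt{D_1}}+\rho\|\nabla f(x_1)\|+\frac{(D_0+4\rho^2L^2)\eta}{\epsilon}+\mathbb E f(w_1)-\Big(\frac{12\rho^2\eta L^2}{\epsilon}+\eta+\rho+(1+\rho L)(2\eta^2L+8\rho^2L)\Big)\ln\epsilon,$$ $$A_3=\sqrt{\tfrac{\rho L}{\epsilon}+1}\,\Big[\frac{4f(x_1)}{\eta}+\frac{8(D_0+4\rho^2L^2)}{\epsilon}+16D_1A_1+\frac{8A_2}{\eta}-\Big(\frac{80\rho^2L^2}{\epsilon}+4\eta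 L\Big)\ln\epsilon+\big(4\eta L(3+\rho L)+8\big)\ln\Big(1+\frac{\rho L}{\epsilon}\Big)\Big],$$ $$A_4=\sqrt{\tfrac{\rho L}{\epsilon}+1}\;\frac{16\big(8(1+2D_2)D_1+3\big)\rho^2L^2}{\epsilon},\qquad A_5=\sqrt{\tfrac{\rho L}{\epsilon}+1}\,\Big[\frac{40\rho^2L^2}{\epsilon}+\frac{4\rho}{\eta}\big(1+8\rho L(1+\rho L)\big)+4\eta L(3+2\rho L)+8\Big],$$ $$A_6=2\sqrt{2D_0T+\epsilon^2}+4D_1A_3+8D_1A_5\ln(4D_1A_5+e),\qquad A_7=2A_4A_6+16D_1A_4A_5+8D_1A_4(A_3+2A_5\ln A_6).$$ Suppose that $A_6>0$ and $A_3+2A_5\ln A_6\ge 0$ (which holds for instance whenever $\epsilon\le 1\le D_1$). Then every $\|\nabla f(x_t)\|$ is integrable and $$\sum_{t=1}^T\mathbb E\|\nabla f(x_t)\|\le\sqrt T\,\Big[2A_6(A_3+2A_5\ln A_6)+2A_7\ln(A_7+e)+4096D_1^2A_4^2\Big(2A_4+\frac{16D_1A_4A_5}{A_6}\Big)^2+1\Big]^{1/2}.$$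 -/

import Mathlib

open MeasureTheory ProbabilityTheory

noncomputable section

namespace LightSAM

/-- The space `ℝ^d` with its Euclidean norm. -/
abbrev Vec (d : ℕ) := EuclideanSpace ℝ (Fin d)

/-- The objective `f(x) = (1/n) ∑ i, f(x, ξ_i)`, where `ℓ i` is the loss `f(·, ξ_i)` of the
`i`-th data point. -/
def fullLoss {d n : ℕ} (ℓ : Fin n → Vec d → ℝ) (x : Vec d) : ℝ :=
  (1 / (n : ℝ)) * ∑ i, ℓ i x

/-- The loss `f(x, B)` of a minibatch `B` of `b` data points: the average of their losses. -/
def batchLoss {d n b : ℕ} (ℓ : Fin n → Vec d → ℝ) (B : Fin b → Fin n) (x : Vec d) : ℝ :=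
  (1 / (b : ℝ)) * ∑ j, ℓ (B j) x

/-- Every `f(·, ξ_i)` is differentiable with `L`-Lipschitz gradient. -/
def IsSmooth {d n : ℕ} (ℓ : Fin n → Vec d → ℝ) (L : ℝ) : Prop :=
  ∀ i, Differentiable ℝ (ℓ i) ∧
    ∀ x y, ‖gradient (ℓ i) x - gradient (ℓ i) y‖ ≤ L * ‖x - y‖

/-- `ξ t` is the minibatch drawn in iteration `t + 1`. The minibatches of different iterations are
independent, and each of the `b` members of a minibatch is uniformly distributed on the data set.
Inside one minibatch any dependence is allowed, so this covers sampling with and without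
replacement. -/
structure IsMinibatchSampling {Ω : Type*} [MeasurableSpace Ω] (μ : Measure Ω) {n b : ℕ}
    (ξ : ℕ → Ω → (Fin b → Fin n)) : Prop where
  measurable : ∀ t, Measurable (ξ t)
  indep : iIndepFun ξ μ
  uniform : ∀ t j i, μ.real {ω | ξ t ω j = i} = 1 / (n : ℝ)

/-- Affine noise variance. Since the minibatch of an iteration is independent of the earlier ones,
the expectation conditional on the past is the expectation. -/
def AffineVariance {Ω : Type*} [MeasurableSpace Ω] (μ : Measure Ω) {d n b : ℕ}
    (ℓ : Fin n → Vec d → ℝ) (ξ : ℕ → Ω → (Fin b → Fin n)) (D₀ D₁ : ℝ) : Prop :=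
  ∀ t x, ∫ ω, ‖gradient (batchLoss ℓ (ξ t ω)) x‖ ^ 2 ∂μ
    ≤ D₀ + D₁ * ‖gradient (fullLoss ℓ) x‖ ^ 2

/-- The variables carried from one iteration to the next: after iteration `t` these are
`x_{t+1}`, `u_t` and `v_t`. -/
structure State (d : ℕ) where
  x : Vec d
  u : ℝ
  v : ℝ

/-- The perturbed point `x + ρ s / √(u + ‖s‖²)`. -/
def perturb {d : ℕ} (ρ u : ℝ) (x s : Vec d) : Vec d :=
  x + (ρ / √(u + ‖s‖ ^ 2)) • s

/-- One iteration of LightSAM-I with minibatch loss `h`. -/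
def step {d : ℕ} (ρ η : ℝ) (h : Vec d → ℝ) (S : State d) : State d :=
  let s := gradient h S.x
  let w := perturb ρ S.u S.x s
  let g := gradient h w
  { x := S.x - (η / √(S.v + ‖g‖ ^ 2)) • g
    u := S.u + ‖s‖ ^ 2
    v := S.v + ‖g‖ ^ 2 }

/-- The state of LightSAM-I after `t` iterations, started at `x₁` with `u₀ = v₀ = ε²`. -/
def run {d n b : ℕ} (ℓ : Fin n → Vec d → ℝ) (ρ η ε : ℝ) (x₁ : Vec d)
    (B : ℕ → (Fin b → Fin n)) : ℕ → State d
  | 0 => { x := x₁, u := ε ^ 2, v := ε ^ 2 }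
  | t + 1 => step ρ η (batchLoss ℓ (B t)) (run ℓ ρ η ε x₁ B t)

/-- The iterate `x_t` of LightSAM-I, for `t = 1, 2, …`. -/
def iterate {d n b : ℕ} (ℓ : Fin n → Vec d → ℝ) (ρ η ε : ℝ) (x₁ : Vec d)
    (B : ℕ → (Fin b → Fin n)) (t : ℕ) : Vec d :=
  (run ℓ ρ η ε x₁ B (t - 1)).x

/-- The numbers on which the constants of the bound depend:
`fx₁ = f(x₁)`, `gx₁ = ‖∇f(x₁)‖`, `gŵ₁ = ‖∇f(ŵ₁)‖`, `fw₁ = E f(w₁)`. -/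
structure Params where
  ρ : ℝ
  η : ℝ
  ε : ℝ
  L : ℝ
  D₀ : ℝ
  D₁ : ℝ
  fx₁ : ℝ
  gx₁ : ℝ
  gŵ₁ : ℝ
  fw₁ : ℝ

namespace Params

variable (p : Params)

def D₂ : ℝ :=
  max (max 1 (4 * p.D₁))
    (32 * (1 + √p.D₁) * p.D₁ * p.ρ * √(p.ρ * p.L + p.ε) / (p.η * √p.ε))

def A₁ : ℝ :=
  p.gŵ₁ ^ 2 / p.ε
    + 4 * (1 + 2 * p.D₂) * p.L ^ 2 / p.ε * (p.η ^ 2 - 4 * p.ρ ^ 2 * Real.log p.ε)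

def A₂ : ℝ :=
  2 * p.ρ ^ 2 * p.L + p.ρ * p.D₀ / (2 * p.ε * √p.D₁) + p.ρ * p.gx₁
    + (p.D₀ + 4 * p.ρ ^ 2 * p.L ^ 2) * p.η / p.ε + p.fw₁
    - (12 * p.ρ ^ 2 * p.η * p.L ^ 2 / p.ε + p.η + p.ρ
        + (1 + p.ρ * p.L) * (2 * p.η ^ 2 * p.L + 8 * p.ρ ^ 2 * p.L)) * Real.log p.ε

def A₃ : ℝ :=
  √(p.ρ * p.L / p.ε + 1) *
    (4 * p.fx₁ / p.η + 8 * (p.D₀ + 4 * p.ρ ^ 2 * p.L ^ 2) / p.ε + 16 * p.D₁ * p.A₁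
      + 8 * p.A₂ / p.η
      - (80 * p.ρ ^ 2 * p.L ^ 2 / p.ε + 4 * p.η * p.L) * Real.log p.ε
      + (4 * p.η * p.L * (3 + p.ρ * p.L) + 8) * Real.log (1 + p.ρ * p.L / p.ε))

def A₄ : ℝ :=
  √(p.ρ * p.L / p.ε + 1) *
    (16 * (8 * (1 + 2 * p.D₂) * p.D₁ + 3) * p.ρ ^ 2 * p.L ^ 2 / p.ε)

def A₅ : ℝ :=
  √(p.ρ * p.L / p.ε + 1) *
    (40 * p.ρ ^ 2 * p.L ^ 2 / p.ε
      + 4 * p.ρ / p.η * (1 + 8 * p.ρ * p.L * (1 + p.ρ * p.L))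
      + 4 * p.η * p.L * (3 + 2 * p.ρ * p.L) + 8)

def A₆ (T : ℕ) : ℝ :=
  2 * √(2 * p.D₀ * T + p.ε ^ 2) + 4 * p.D₁ * p.A₃
    + 8 * p.D₁ * p.A₅ * Real.log (4 * p.D₁ * p.A₅ + Real.exp 1)

def A₇ (T : ℕ) : ℝ :=
  2 * p.A₄ * p.A₆ T + 16 * p.D₁ * p.A₄ * p.A₅
    + 8 * p.D₁ * p.A₄ * (p.A₃ + 2 * p.A₅ * Real.log (p.A₆ T))

/-- The expression under the square root in the bound. -/
def bracket (T : ℕ) : ℝ :=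
  2 * p.A₆ T * (p.A₃ + 2 * p.A₅ * Real.log (p.A₆ T))
    + 2 * p.A₇ T * Real.log (p.A₇ T + Real.exp 1)
    + 4096 * p.D₁ ^ 2 * p.A₄ ^ 2 * (2 * p.A₄ + 16 * p.D₁ * p.A₄ * p.A₅ / p.A₆ T) ^ 2 + 1

end Params

/-- The parameters of the bound for a run of LightSAM-I. Here
`ŵ₁ = x₁ + ρ ∇f(x₁) / √(ε² + ‖∇f(x₁)‖²)`, and `w₁` is the (random) perturbed point of the first
iteration, `w₁ = x₁ + ρ s₁ / √(ε² + ‖s₁‖²)` with `s₁ = ∇f(x₁, ξ₁)`. -/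
def params {Ω : Type*} [MeasurableSpace Ω] (μ : Measure Ω) {d n b : ℕ}
    (ℓ : Fin n → Vec d → ℝ) (ξ : ℕ → Ω → (Fin b → Fin n))
    (ρ η ε L D₀ D₁ : ℝ) (x₁ : Vec d) : Params where
  ρ := ρ
  η := η
  ε := ε
  L := L
  D₀ := D₀
  D₁ := D₁
  fx₁ := fullLoss ℓ x₁
  gx₁ := ‖gradient (fullLoss ℓ) x₁‖
  gŵ₁ := ‖gradient (fullLoss ℓ) (perturb ρ (ε ^ 2) x₁ (gradient (fullLoss ℓ) x₁))‖
  fw₁ := ∫ ω, fullLoss ℓ (perturb ρ (ε ^ 2) x₁ (gradient (batchLoss ℓ (ξ 0 ω)) x₁)) ∂μ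

end LightSAM

end

/-! Write `n`, `S`, `G` for the norms of `∇f(x)`, `s`, `g`, put `c = ρL` and `κ = √(1 + c/ε)`, and
let `u t`, `v t` be the accumulators before iteration `t + 1`, so that they do not depend on its
minibatch.

Descent. In the descent inequality for `f` the step size `1/√v (t+1)` is replaced by the predictable
`1/√v t`; this costs `n G (1/√v t - 1/√v (t+1))`, which Young's inequality splits into a small
multiple of `n²/√v` and a nearly telescoping sum. The perturbation moves the gradient by at most `c
S/√u`, and the squares of `S/√u` sum to a logarithm. Hence `Γ = E ∑ n²/√v` is at most a constant
plus a multiple of `log E√u_T` (`integral_sum_le_of_le`).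

Growth. Iterations with `D₁n² ≤ D₀` contribute at most `2D₀` each to `E u_T`; the others are
controlled by `Γ` itself. So `Y = E max(√u_T, c)` is at most `√(2D₀T + ε²)` plus a multiple of `Γ`
and a correction of size `c` (`integral_max_sqrt_le`). Pathwise `√v ≤ 2κ max(√u, c)`
(`sqrt_v_le_max`), and Cauchy–Schwarz gives `(∑ E n)² ≤ T Γ E√v_T ≤ T (2κΓ) Y`. For `D₁ < 1/2`,
unbiasedness already forces `n² ≤ 2D₀`, and `Y` may be taken to be `√(2D₀T + ε²)`.

Decoupling. With `g` equal to `2κΓ` plus a slack, `g ≲ log Y` and `Y ≲ g` are solved for `gY` by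
tangent lines of the logarithm (`mul_le_of_coupled`). What remains is to check that the explicit
constants dominate (`le_bracket`).

The first `T` minibatches take finitely many values, so the argument runs on their joint law, where
integrability and measurability are automatic. -/

noncomputable section

/-! ### Smoothness of the full and minibatch losses -/

namespace LightSAM

open scoped RealInnerProductSpace

/-- A function with `L`-Lipschitz gradient lies below its quadratic upper model. -/
theorem le_quadratic_of_lipschitz_gradient {E : Type*} [NormedAddCommGroup E]
    [InnerProductSpace ℝ E] [CompleteSpace E] {f : E → ℝ} {L : ℝ}
    (hf : Differentiable ℝ f) (hL : ∀ x y, ‖gradient f x - gradient f y‖ ≤ L * ‖x - y‖) (x h : E) :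
    f (x + h) ≤ f x + ⟪gradient f x, h⟫ + L / 2 * ‖h‖ ^ 2 := by
  set φ : ℝ → ℝ := fun r => f (x + r • h) - r * ⟪gradient f x, h⟫ - L / 2 * r ^ 2 * ‖h‖ ^ 2
  have hline : ∀ r : ℝ, HasDerivAt (fun r : ℝ => x + r • h) h r := fun r => by
    simpa using ((hasDerivAt_id r).smul_const h).const_add x
  have hφ : ∀ r, HasDerivAt φ (⟪gradient f (x + r • h), h⟫ - ⟪gradient f x, h⟫
      - L * r * ‖h‖ ^ 2) r := fun r => by
    have h1 := (hf (x + r • h)).hasFDerivAt.comp_hasDerivAt r (hline r)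
    rw [← inner_gradient_left] at h1
    have h2 := (hasDerivAt_id r).mul_const ⟪gradient f x, h⟫
    have h3 := (((hasDerivAt_id r).pow 2).const_mul (L / 2)).mul_const (‖h‖ ^ 2)
    refine ((h1.sub h2).sub h3).congr_deriv ?_
    simp only [id, Nat.add_one_sub_one, pow_one, Nat.cast_ofNat]
    ring
  have hanti : AntitoneOn φ (Set.Icc 0 1) := by
    refine antitoneOn_of_deriv_nonpos (convex_Icc 0 1)
      (fun r _ => (hφ r).continuousAt.continuousWithinAt)
      (fun r _ => (hφ r).differentiableAt.differentiableWithinAt) fun r hr => ?_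
    rw [interior_Icc] at hr
    rw [(hφ r).deriv, ← inner_sub_left]
    have h1 := real_inner_le_norm (gradient f (x + r • h) - gradient f x) h
    have h2 := hL (x + r • h) x
    rw [add_sub_cancel_left, norm_smul, Real.norm_of_nonneg hr.1.le] at h2
    nlinarith [mul_le_mul_of_nonneg_right h2 (norm_nonneg h)]
  have h01 := hanti (Set.left_mem_Icc.2 zero_le_one) (Set.right_mem_Icc.2 zero_le_one) zero_le_one
  simp only [φ, one_smul, zero_smul, add_zero] at h01
  linarith

variable {d n b : ℕ} {ℓ : Fin n → Vec d → ℝ} {L : ℝ}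

theorem hasGradientAt_average {ι : Type*} (s : Finset ι) (k : ℝ) {h : ι → Vec d → ℝ}
    (hd : ∀ i, Differentiable ℝ (h i)) (x : Vec d) :
    HasGradientAt (fun y => k * ∑ i ∈ s, h i y) (k • ∑ i ∈ s, gradient (h i) x) x := by
  have h1 : ∀ i ∈ s, HasFDerivAt (h i) (InnerProductSpace.toDual ℝ _ (gradient (h i) x)) x :=
    fun i _ => ((hd i) x).hasGradientAt.hasFDerivAt
  have h2 := (HasFDerivAt.fun_sum h1).const_mul k
  rw [hasGradientAt_iff_hasFDerivAt]
  refine h2.congr_fderiv ?_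
  rw [map_smul, map_sum]

theorem gradient_fullLoss (h : IsSmooth ℓ L) (x : Vec d) :
    gradient (fullLoss ℓ) x = (1 / (n : ℝ)) • ∑ i, gradient (ℓ i) x :=
  (hasGradientAt_average Finset.univ _ (fun i => (h i).1) x).gradient

theorem gradient_batchLoss (h : IsSmooth ℓ L) (B : Fin b → Fin n) (x : Vec d) :
    gradient (batchLoss ℓ B) x = (1 / (b : ℝ)) • ∑ j, gradient (ℓ (B j)) x :=
  (hasGradientAt_average Finset.univ _ (fun j => (h (B j)).1) x).gradient

theorem differentiable_fullLoss (h : IsSmooth ℓ L) : Differentiable ℝ (fullLoss ℓ) := fun x =>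
  (hasGradientAt_average Finset.univ _ (fun i => (h i).1) x).differentiableAt

theorem norm_average_sub_le {ι : Type*} [Fintype ι] {m : ℕ} (hm : 0 < m)
    (hcard : Fintype.card ι = m) {F G : ι → Vec d} {K : ℝ} (hFG : ∀ i, ‖F i - G i‖ ≤ K) :
    ‖(1 / (m : ℝ)) • ∑ i, F i - (1 / (m : ℝ)) • ∑ i, G i‖ ≤ K := by
  have hm' : (0 : ℝ) < m := by exact_mod_cast hm
  rw [← smul_sub, ← Finset.sum_sub_distrib, norm_smul, Real.norm_of_nonneg (by positivity)]
  have h1 : ‖∑ i, (F i - G i)‖ ≤ m * K := by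
    refine (norm_sum_le_of_le _ fun i _ => hFG i).trans ?_
    simp [hcard]
  calc 1 / (m : ℝ) * ‖∑ i, (F i - G i)‖ ≤ 1 / m * (m * K) := by gcongr
    _ = K := by field_simp

theorem lipschitz_gradient_fullLoss (hn : 0 < n) (h : IsSmooth ℓ L) (x y : Vec d) :
    ‖gradient (fullLoss ℓ) x - gradient (fullLoss ℓ) y‖ ≤ L * ‖x - y‖ := by
  rw [gradient_fullLoss h, gradient_fullLoss h]
  exact norm_average_sub_le hn (by simp) fun i => (h i).2 x y

theorem lipschitz_gradient_batchLoss (hb : 0 < b) (h : IsSmooth ℓ L) (B : Fin b → Fin n)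
    (x y : Vec d) :
    ‖gradient (batchLoss ℓ B) x - gradient (batchLoss ℓ B) y‖ ≤ L * ‖x - y‖ := by
  rw [gradient_batchLoss h, gradient_batchLoss h]
  exact norm_average_sub_le hb (by simp) fun j => (h (B j)).2 x y

end LightSAM

/-! ### Pathwise inequalities -/

namespace LightSAM

/-- `w` accumulates the squares of `q`, starting from `ε²`. -/
structure Accumulates (ε : ℝ) (q w : ℕ → ℝ) : Prop where
  pos : 0 < ε
  zero : w 0 = ε ^ 2
  succ : ∀ t, w (t + 1) = w t + q t ^ 2

namespace Accumulates

variable {ε : ℝ} {q w : ℕ → ℝ} (h : Accumulates ε q w)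
include h

theorem sq_le (t : ℕ) : ε ^ 2 ≤ w t := by
  induction t with
  | zero => exact h.zero.ge
  | succ t ih => rw [h.succ]; nlinarith [sq_nonneg (q t)]

theorem acc_pos (t : ℕ) : 0 < w t := (pow_pos h.pos 2).trans_le (h.sq_le t)

theorem le_sqrt (t : ℕ) : ε ≤ √(w t) := Real.le_sqrt_of_sq_le (h.sq_le t)

theorem sqrt_pos (t : ℕ) : 0 < √(w t) := Real.sqrt_pos.2 (h.acc_pos t)

theorem mono : Monotone w :=
  monotone_nat_of_le_succ fun t => by rw [h.succ]; nlinarith [sq_nonneg (q t)]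

theorem sq_sqrt (t : ℕ) : √(w t) ^ 2 = w t := Real.sq_sqrt (h.acc_pos t).le

theorem inv_sqrt_succ_le (t : ℕ) : 1 / √(w (t + 1)) ≤ 1 / √(w t) :=
  one_div_le_one_div_of_le (h.sqrt_pos t) (Real.sqrt_le_sqrt (h.mono t.le_succ))

theorem inv_sqrt_le (t : ℕ) : 1 / √(w t) ≤ 1 / ε := one_div_le_one_div_of_le h.pos (h.le_sqrt t)

theorem eq_add_sum (T : ℕ) : w T = ε ^ 2 + ∑ t ∈ Finset.range T, q t ^ 2 := by
  induction T with
  | zero => simp [h.zero]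
  | succ T ih => rw [h.succ, ih, Finset.sum_range_succ]; ring

/-- Each term equals `1 - w t / w (t+1)`, which is at most `log (w (t+1) / w t)`, and these
logarithms telescope. -/
theorem sum_div_le_log (T : ℕ) :
    ∑ t ∈ Finset.range T, q t ^ 2 / w (t + 1) ≤ Real.log (w T / ε ^ 2) := by
  have hε := pow_pos h.pos 2
  induction T with
  | zero => simp [h.zero, hε.ne']
  | succ T ih =>
    rw [Finset.sum_range_succ]
    have h0 := h.acc_pos T
    have h1 := h.acc_pos (T + 1)
    have h2 := Real.one_sub_inv_le_log_of_pos (div_pos h1 h0)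
    have h3 : q T ^ 2 / w (T + 1) = 1 - (w (T + 1) / w T)⁻¹ := by
      rw [inv_div, eq_sub_iff_add_eq, ← add_div, add_comm, ← h.succ, div_self h1.ne']
    have h4 : Real.log (w (T + 1) / ε ^ 2)
        = Real.log (w (T + 1) / w T) + Real.log (w T / ε ^ 2) := by
      rw [← Real.log_mul (div_pos h1 h0).ne' (div_pos h0 hε).ne']
      congr 1
      field_simp
    rw [h3, h4]
    linarith

/-- The terms `q²/w^{3/2}` are dominated by the telescoping differences `2 (1/√w t - 1/√w (t+1))`.
-/
theorem sum_div_mul_sqrt_le (T : ℕ) :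
    ∑ t ∈ Finset.range T, q t ^ 2 / w (t + 1) * (1 / √(w (t + 1))) ≤ 2 / ε := by
  suffices H : ∑ t ∈ Finset.range T, q t ^ 2 / w (t + 1) * (1 / √(w (t + 1)))
      ≤ 2 * (1 / ε - 1 / √(w T)) by
    have := one_div_pos.2 (h.sqrt_pos T)
    have h2 : 2 / ε = 2 * (1 / ε) := by ring
    linarith
  induction T with
  | zero => simp [h.zero, Real.sqrt_sq h.pos.le]
  | succ T ih =>
    rw [Finset.sum_range_succ]
    suffices H : q T ^ 2 / w (T + 1) * (1 / √(w (T + 1)))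
        ≤ 2 * (1 / √(w T) - 1 / √(w (T + 1))) by linarith
    have h0 := h.sqrt_pos T
    have h1 := h.sqrt_pos (T + 1)
    have h2 := Real.sqrt_le_sqrt (h.mono T.le_succ)
    have h3 : q T ^ 2 = √(w (T + 1)) ^ 2 - √(w T) ^ 2 := by
      rw [h.sq_sqrt, h.sq_sqrt, h.succ]; ring
    rw [h3]
    nth_rewrite 2 [← h.sq_sqrt (T + 1)]
    generalize √(w (T + 1)) = y at *
    generalize √(w T) = x at *
    have h4 : 2 * (1 / x - 1 / y) - (y ^ 2 - x ^ 2) / y ^ 2 * (1 / y)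
        = (y - x) * (2 * y ^ 2 - x * (y + x)) / (x * y ^ 3) := by field_simp; ring
    have h5 : 0 ≤ (y - x) * (2 * y ^ 2 - x * (y + x)) / (x * y ^ 3) := by
      refine div_nonneg (mul_nonneg (by linarith) (by nlinarith)) (by positivity)
    linarith

end Accumulates

/-- The scalar quantities of a run of LightSAM-I: `F` the objective values, `n` the gradient norms,
`ip` the products `⟨∇f(x), s⟩`, `S` and `G` the norms of `s` and `g`; `c` is `ρL`. -/
structure Trajectory (c ε η L : ℝ) (F n ip S G u v : ℕ → ℝ) : Prop where
  accU : Accumulates ε S u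
  accV : Accumulates ε G v
  c_nonneg : 0 ≤ c
  η_pos : 0 < η
  L_nonneg : 0 ≤ L
  F_nonneg : ∀ t, 0 ≤ F t
  n_nonneg : ∀ t, 0 ≤ n t
  S_nonneg : ∀ t, 0 ≤ S t
  G_nonneg : ∀ t, 0 ≤ G t
  G_le : ∀ t, G t ≤ S t + c * (S t / √(u (t + 1)))
  n_succ : ∀ t, n (t + 1) ≤ n t + η * L * (G t / √(v (t + 1)))
  -- The three error terms come from the gradient at the perturbed point, from replacing `1/√v
  -- (t+1)` by the predictable `1/√v t`, and from the quadratic term of smoothness.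
  descent : ∀ t, F (t + 1) ≤ F t - η * (ip t * (1 / √(v t)))
    + η * (n t * (c * (S t / √(u (t + 1)))) * (1 / √(v t)))
    + η * (n t * G t * (1 / √(v t) - 1 / √(v (t + 1)))) + L * η ^ 2 / 2 * (G t ^ 2 / v (t + 1))

theorem sq_add_sq_le_minkowski {c : ℝ} (hc : 0 ≤ c) (p q s r : ℝ) :
    (p + c * q) ^ 2 + (s + c * r) ^ 2 ≤ (√(p ^ 2 + s ^ 2) + c * √(q ^ 2 + r ^ 2)) ^ 2 := by
  have e1 := Real.sq_sqrt (add_nonneg (sq_nonneg p) (sq_nonneg s))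
  have e2 := Real.sq_sqrt (add_nonneg (sq_nonneg q) (sq_nonneg r))
  have key : p * q + s * r ≤ √(p ^ 2 + s ^ 2) * √(q ^ 2 + r ^ 2) := by
    refine (abs_le_of_sq_le_sq' ?_ (by positivity)).2
    rw [mul_pow, e1, e2]
    nlinarith [sq_nonneg (p * r - s * q)]
  have e3 : c ^ 2 * √(q ^ 2 + r ^ 2) ^ 2 = c ^ 2 * (q ^ 2 + r ^ 2) := by rw [e2]
  nlinarith [mul_le_mul_of_nonneg_left key hc]

/-- Since `log (z²/ε²) ≤ 2z/ε` and `c ≤ z`, the second summand is at most `z √(2c/ε)`; then `1 +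
√(2k) ≤ 2√(1 + k)` with `k = c/ε`. -/
theorem add_mul_sqrt_log_le {c ε z : ℝ} (hε : 0 < ε) (hc : 0 ≤ c) (hεz : ε ≤ z) (hcz : c ≤ z) :
    z + c * √(Real.log (z ^ 2 / ε ^ 2)) ≤ 2 * √(1 + c / ε) * z := by
  have hz : 0 < z := hε.trans_le hεz
  have h1 : Real.log (z ^ 2 / ε ^ 2) ≤ 2 * (z / ε) := by
    rw [← div_pow, Real.log_pow]
    have := Real.log_le_sub_one_of_pos (div_pos hz hε)
    push_cast
    linarith
  have h2 : c * √(Real.log (z ^ 2 / ε ^ 2)) ≤ z * √(2 * (c / ε)) := by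
    calc c * √(Real.log (z ^ 2 / ε ^ 2)) ≤ c * √(2 * (z / ε)) := by gcongr
      _ = √(c ^ 2 * (2 * (z / ε))) := by rw [Real.sqrt_mul (sq_nonneg c), Real.sqrt_sq hc]
      _ ≤ √(z ^ 2 * (2 * (c / ε))) := by
        apply Real.sqrt_le_sqrt
        have h3 : z ^ 2 * (2 * (c / ε)) - c ^ 2 * (2 * (z / ε)) = 2 * (c / ε) * (z * (z - c)) := by
          ring
        have h4 : 0 ≤ 2 * (c / ε) * (z * (z - c)) :=
          mul_nonneg (by positivity) (mul_nonneg hz.le (by linarith))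
        linarith
      _ = z * √(2 * (c / ε)) := by rw [Real.sqrt_mul (sq_nonneg z), Real.sqrt_sq hz.le]
  have hk : 0 ≤ c / ε := by positivity
  have h5 : 1 + √(2 * (c / ε)) ≤ 2 * √(1 + c / ε) := by
    generalize c / ε = k at *
    have h6 := Real.sq_sqrt (show 0 ≤ 2 * k by linarith)
    have h7 := Real.sq_sqrt (show 0 ≤ 1 + k by linarith)
    refine abs_le_of_sq_le_sq' ?_ (by positivity) |>.2
    nlinarith [sq_nonneg (√(2 * k) - 2)]
  nlinarith

namespace Trajectory

variable {c ε η L : ℝ} {F n ip S G u v : ℕ → ℝ} (h : Trajectory c ε η L F n ip S G u v)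
include h

theorem ratio_sq (t : ℕ) : (S t / √(u (t + 1))) ^ 2 = S t ^ 2 / u (t + 1) := by
  rw [div_pow, h.accU.sq_sqrt]

theorem ratio_le_one (t : ℕ) : S t / √(u (t + 1)) ≤ 1 := by
  refine div_le_one_of_le₀ (Real.le_sqrt_of_sq_le ?_) (Real.sqrt_nonneg _)
  rw [h.accU.succ]
  linarith [h.accU.acc_pos t]

theorem G_sq_le (t : ℕ) : G t ^ 2 ≤ 2 * S t ^ 2 + 2 * c ^ 2 := by
  have h1 : G t ≤ S t + c := by
    have := mul_le_mul_of_nonneg_left (h.ratio_le_one t) h.c_nonneg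
    linarith [h.G_le t]
  nlinarith [h.G_nonneg t, sq_nonneg (S t - c), h.S_nonneg t, h.c_nonneg]

/-- A crude comparison, from `√u ≥ ε`. It is used only inside a logarithm, where the factor becomes
an additive constant. -/
theorem v_le (t : ℕ) : v t ≤ (1 + c / ε) ^ 2 * u t := by
  have hε := h.accU.pos
  have hc := h.c_nonneg
  have hk : 0 ≤ c / ε := by positivity
  induction t with
  | zero =>
    rw [h.accU.zero, h.accV.zero]
    nlinarith [pow_pos hε 2, mul_nonneg hk (sq_nonneg ε),
      mul_nonneg (sq_nonneg (c / ε)) (sq_nonneg ε)]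
  | succ t ih =>
    have h1 : G t ≤ (1 + c / ε) * S t := by
      have h2 : c * (S t / √(u (t + 1))) ≤ c / ε * S t := by
        rw [div_mul_eq_mul_div, ← mul_div_assoc]
        exact div_le_div_of_nonneg_left (mul_nonneg hc (h.S_nonneg t)) hε (h.accU.le_sqrt _)
      linarith [h.G_le t]
    have h3 := pow_le_pow_left₀ (h.G_nonneg t) h1 2
    rw [h.accU.succ, h.accV.succ]
    nlinarith

/-- Minkowski's inequality for the sequences `S` and `c S/√u`, one index at a time. -/
theorem v_le_sq (T : ℕ) : v T ≤ (√(u T)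
    + c * √(∑ t ∈ Finset.range T, S t ^ 2 / u (t + 1))) ^ 2 := by
  induction T with
  | zero => simp [h.accU.zero, h.accV.zero, Real.sq_sqrt (sq_nonneg ε)]
  | succ T ih =>
    have hQ0 : 0 ≤ ∑ t ∈ Finset.range T, S t ^ 2 / u (t + 1) :=
      Finset.sum_nonneg fun t _ => div_nonneg (sq_nonneg _) (h.accU.acc_pos _).le
    have hG := pow_le_pow_left₀ (h.G_nonneg T) (h.G_le T) 2
    have hM := sq_add_sq_le_minkowski h.c_nonneg (√(u T))
      (√(∑ t ∈ Finset.range T, S t ^ 2 / u (t + 1))) (S T) (S T / √(u (T + 1)))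
    rw [h.accU.sq_sqrt, Real.sq_sqrt hQ0, ← h.accU.succ, h.ratio_sq] at hM
    rw [h.accV.succ, Finset.sum_range_succ]
    linarith

theorem sqrt_v_le (T : ℕ) : √(v T) ≤ √(u T) + c * √(Real.log (u T / ε ^ 2)) := by
  have hc := h.c_nonneg
  refine (Real.sqrt_le_sqrt (h.v_le_sq T)).trans ?_
  rw [Real.sqrt_sq (by positivity)]
  gcongr
  exact h.accU.sum_div_le_log T

/-- Compared with `v_le`, the factor is of order `√(1 + c/ε)` instead of `1 + c/ε`; the price is the
truncation of `√u` at `c`. -/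
theorem sqrt_v_le_max (T : ℕ) : √(v T) ≤ 2 * √(1 + c / ε) * max (√(u T)) c := by
  have hε := h.accU.pos
  have hc := h.c_nonneg
  have hu := h.accU.sqrt_pos T
  refine (h.sqrt_v_le T).trans (le_trans ?_ (add_mul_sqrt_log_le hε hc
    ((h.accU.le_sqrt T).trans (le_max_left _ _)) (le_max_right _ _)))
  gcongr
  · exact le_max_left _ _
  · exact div_pos (h.accU.acc_pos T) (by positivity)
  · nth_rewrite 1 [← h.accU.sq_sqrt T]
    gcongr
    exact le_max_left _ _

/-- Summation by parts moves the difference onto `n²`. There `n_succ` bounds the increment by a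
multiple of `G/√v`, and Young's inequality leaves `n²/8` and a multiple of `G²/v`; weighted by
`1/√v`, the latter is summable by `sum_div_mul_sqrt_le`. -/
theorem sum_sq_mul_decrease_le {D₁ : ℝ} (hD₁ : 0 < D₁) (T : ℕ) :
    ∑ t ∈ Finset.range T, 2 * D₁ * n t ^ 2 * (1 / √(v t) - 1 / √(v (t + 1)))
      ≤ 2 * D₁ * n 0 ^ 2 / ε + (∑ t ∈ Finset.range T, n t ^ 2 * (1 / √(v t)) / 8)
        + 64 * D₁ ^ 2 * η ^ 2 * L ^ 2 / ε := by
  have hε := h.accV.pos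
  have hr : ∀ t, 0 ≤ 1 / √(v t) := fun t => one_div_nonneg.2 (Real.sqrt_nonneg _)
  rcases T with _ | T
  · simp only [Finset.range_zero, Finset.sum_empty]
    positivity
  have tele : ∀ T, ∑ t ∈ Finset.range (T + 1), n t ^ 2 * (1 / √(v t) - 1 / √(v (t + 1)))
      ≤ n 0 ^ 2 / ε + (∑ t ∈ Finset.range T, (n (t + 1) ^ 2 - n t ^ 2) * (1 / √(v (t + 1))))
        - n T ^ 2 * (1 / √(v (T + 1))) := by
    intro T
    induction T with
    | zero =>
      simp [h.accV.zero, Real.sqrt_sq hε.le, mul_sub, div_eq_mul_inv]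
    | succ T ih =>
      rw [Finset.sum_range_succ _ (T + 1),
        Finset.sum_range_succ (fun t => (n (t + 1) ^ 2 - n t ^ 2) * (1 / √(v (t + 1)))) T]
      linarith
  have step : ∀ t, 2 * D₁ * ((n (t + 1) ^ 2 - n t ^ 2) * (1 / √(v (t + 1))))
      ≤ n (t + 1) ^ 2 * (1 / √(v (t + 1))) / 8
        + 32 * D₁ ^ 2 * η ^ 2 * L ^ 2 * (G t ^ 2 / v (t + 1) * (1 / √(v (t + 1)))) := by
    intro t
    have h1 := h.n_succ t
    have h2 : G t ^ 2 / v (t + 1) = (G t / √(v (t + 1))) ^ 2 := by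
      rw [div_pow, h.accV.sq_sqrt]
    have h3 : 0 ≤ G t / √(v (t + 1)) := div_nonneg (h.G_nonneg t) (Real.sqrt_nonneg _)
    rw [h2]
    have h4 := hr (t + 1)
    have n0 := h.n_nonneg t
    have n1 := h.n_nonneg (t + 1)
    have hη := h.η_pos
    have hL := h.L_nonneg
    generalize 1 / √(v (t + 1)) = r at *
    generalize G t / √(v (t + 1)) = τ at *
    have h5 : n (t + 1) ^ 2 - n t ^ 2 ≤ 2 * n (t + 1) * (η * L * τ) := by
      nlinarith [sq_nonneg (n (t + 1) - n t), mul_le_mul_of_nonneg_left h1 n1]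
    have h6 : 2 * D₁ * (n (t + 1) ^ 2 - n t ^ 2)
        ≤ n (t + 1) ^ 2 / 8 + 32 * D₁ ^ 2 * η ^ 2 * L ^ 2 * τ ^ 2 := by
      have := mul_le_mul_of_nonneg_left h5 (by linarith : (0 : ℝ) ≤ 2 * D₁)
      nlinarith [sq_nonneg (n (t + 1) - 16 * D₁ * (η * L * τ))]
    have := mul_le_mul_of_nonneg_right h6 h4
    linarith
  have hsum := Finset.sum_le_sum fun t (_ : t ∈ Finset.range T) => step t
  rw [← Finset.mul_sum, Finset.sum_add_distrib, ← Finset.mul_sum] at hsum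
  have h3 := mul_le_mul_of_nonneg_left (h.accV.sum_div_mul_sqrt_le T)
    (by positivity : 0 ≤ 32 * D₁ ^ 2 * η ^ 2 * L ^ 2)
  have h4 := mul_le_mul_of_nonneg_left (tele T) (by linarith : (0 : ℝ) ≤ 2 * D₁)
  -- The increments only produce the terms with index at least 1; the term with index 0 is added for
  -- free.
  have h5 : 0 ≤ n 0 ^ 2 * (1 / √(v 0)) / 8 := by have := hr 0; positivity
  have h6 : 0 ≤ 2 * D₁ * (n T ^ 2 * (1 / √(v (T + 1)))) := by have := hr (T + 1); positivity
  rw [Finset.sum_range_succ' (fun t => n t ^ 2 * (1 / √(v t)) / 8)]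
  have e1 : ∑ t ∈ Finset.range (T + 1), 2 * D₁ * n t ^ 2 * (1 / √(v t) - 1 / √(v (t + 1)))
      = 2 * D₁ * ∑ t ∈ Finset.range (T + 1), n t ^ 2 * (1 / √(v t) - 1 / √(v (t + 1))) := by
    rw [Finset.mul_sum]
    exact Finset.sum_congr rfl fun t _ => by ring
  rw [e1]
  have e2 : 32 * D₁ ^ 2 * η ^ 2 * L ^ 2 * (2 / ε) = 64 * D₁ ^ 2 * η ^ 2 * L ^ 2 / ε := by ring
  have e3 : 2 * D₁ * (n 0 ^ 2 / ε) = 2 * D₁ * n 0 ^ 2 / ε := by ring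
  linarith

/-- The summed descent inequality. The left side has expectation at least half of that of
`∑ n² / √v`. -/
theorem sum_le {D₀ D₁ : ℝ} (hD₀ : 0 < D₀) (hD₁ : 0 < D₁) (T : ℕ) :
    ∑ t ∈ Finset.range T, (ip t * (1 / √(v t)) - n t ^ 2 * (1 / √(v t)) / 4
        - n t ^ 2 * (1 / √(v t)) / (4 * (D₀ + c ^ 2 + D₁ * n t ^ 2)) * (S t ^ 2 + c ^ 2))
      ≤ F 0 / η + 2 * (D₀ + c ^ 2) / ε + 2 * D₁ * n 0 ^ 2 / ε + 64 * D₁ ^ 2 * η ^ 2 * L ^ 2 / ε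
        + 2 * c ^ 2 / ε * Real.log (u T / ε ^ 2) + L * η / 2 * Real.log (v T / ε ^ 2) := by
  have hε := h.accV.pos
  have hη := h.η_pos
  have hL := h.L_nonneg
  -- Of the subtracted `n²/(4√v)`, half absorbs the perturbation error (`h1`); the other half stays
  -- for `sum_sq_mul_decrease_le`.
  have step : ∀ t, (ip t * (1 / √(v t)) - n t ^ 2 * (1 / √(v t)) / 4
        - n t ^ 2 * (1 / √(v t)) / (4 * (D₀ + c ^ 2 + D₁ * n t ^ 2)) * (S t ^ 2 + c ^ 2))
      ≤ (F t / η + 2 * (D₀ + c ^ 2) * (1 / √(v t)))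
        - (F (t + 1) / η + 2 * (D₀ + c ^ 2) * (1 / √(v (t + 1))))
        + 2 * D₁ * n t ^ 2 * (1 / √(v t) - 1 / √(v (t + 1)))
        - n t ^ 2 * (1 / √(v t)) / 8
        + 2 * c ^ 2 / ε * (S t ^ 2 / u (t + 1)) + L * η / 2 * (G t ^ 2 / v (t + 1)) := by
    intro t
    have hd : F (t + 1) / η ≤ F t / η - ip t * (1 / √(v t))
        + n t * (c * (S t / √(u (t + 1)))) * (1 / √(v t))
        + n t * G t * (1 / √(v t) - 1 / √(v (t + 1))) + L * η / 2 * (G t ^ 2 / v (t + 1)) := by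
      rw [div_le_iff₀ hη]
      refine (h.descent t).trans (le_of_eq ?_)
      field_simp
    have hr : 0 ≤ 1 / √(v t) := one_div_nonneg.2 (Real.sqrt_nonneg _)
    have h1 : n t * (c * (S t / √(u (t + 1)))) * (1 / √(v t))
        ≤ n t ^ 2 * (1 / √(v t)) / 8 + 2 * c ^ 2 / ε * (S t ^ 2 / u (t + 1)) := by
      rw [← h.ratio_sq]
      have hr' := h.accV.inv_sqrt_le t
      have e : 2 * c ^ 2 / ε = 2 * c ^ 2 * (1 / ε) := by ring
      rw [e]
      generalize S t / √(u (t + 1)) = σ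
      have h2 := mul_le_mul_of_nonneg_left hr' (by positivity : 0 ≤ 2 * c ^ 2 * σ ^ 2)
      nlinarith [mul_nonneg hr (sq_nonneg (n t - 4 * (c * σ)))]
    -- Young's inequality with weight `m = D₀ + c² + D₁n²`, an upper bound for the conditional mean
    -- of `S² + c²`: in expectation the first term is at most `n²/(4√v)`.
    have h2 : n t * G t * (1 / √(v t) - 1 / √(v (t + 1)))
        ≤ n t ^ 2 * (1 / √(v t)) / (4 * (D₀ + c ^ 2 + D₁ * n t ^ 2)) * (S t ^ 2 + c ^ 2)
          + 2 * (D₀ + c ^ 2 + D₁ * n t ^ 2) * (1 / √(v t) - 1 / √(v (t + 1))) := by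
      set m := D₀ + c ^ 2 + D₁ * n t ^ 2 with hm
      have hm0 : 0 < m := by positivity
      have hG : n t ^ 2 * (1 / √(v t)) / (8 * m) * G t ^ 2
          ≤ n t ^ 2 * (1 / √(v t)) / (4 * m) * (S t ^ 2 + c ^ 2) := by
        have := mul_le_mul_of_nonneg_left (h.G_sq_le t)
          (by positivity : 0 ≤ n t ^ 2 * (1 / √(v t)) / (8 * m))
        refine this.trans (le_of_eq ?_)
        field_simp
        ring
      refine le_trans ?_ (add_le_add_left hG _)
      have p0 := h.accV.sqrt_pos t
      have p1 := h.accV.sqrt_pos (t + 1)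
      have hle := Real.sqrt_le_sqrt (h.accV.mono t.le_succ)
      have hG2 : G t ^ 2 = √(v (t + 1)) ^ 2 - √(v t) ^ 2 := by
        rw [h.accV.sq_sqrt, h.accV.sq_sqrt, h.accV.succ]; ring
      have g0 := h.G_nonneg t
      generalize √(v t) = x at *
      generalize √(v (t + 1)) = y at *
      generalize G t = g at *
      have hΔ : 1 / x - 1 / y = g ^ 2 * (1 / x) / (y * (x + y)) := by
        rw [hG2]; field_simp; ring
      have hgy : g ≤ y := by nlinarith
      -- With `Δ = 1/x - 1/y`, this `k` satisfies both `Δ ≤ k/x`, because `g ≤ y`, and `k²/x ≤ Δ`.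
      -- So Young's inequality applied to `n g k` returns a single power of `Δ`.
      set k := g / (x + y) with hk
      have k0 : 0 ≤ k := by positivity
      have h3 : n t * g * (1 / x - 1 / y) ≤ n t * g * k * (1 / x) := by
        have : n t * g * k * (1 / x) - n t * g * (1 / x - 1 / y)
            = n t * g ^ 2 * (y - g) / (x * y * (x + y)) := by
          rw [hΔ, hk]; field_simp
        have h4 : 0 ≤ n t * g ^ 2 * (y - g) / (x * y * (x + y)) := by
          have := h.n_nonneg t
          apply div_nonneg (mul_nonneg (by positivity) (by linarith)) (by positivity)
        linarith
      have h5 : k ^ 2 * (1 / x) ≤ 1 / x - 1 / y := by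
        have : 1 / x - 1 / y - k ^ 2 * (1 / x) = g ^ 2 / (y * (x + y) ^ 2) := by
          rw [hΔ, hk]; field_simp; ring
        have h4 : 0 ≤ g ^ 2 / (y * (x + y) ^ 2) := by positivity
        linarith
      have h6 : n t * g * k ≤ n t ^ 2 / (8 * m) * g ^ 2 + 2 * m * k ^ 2 := by
        have : n t ^ 2 / (8 * m) * g ^ 2 + 2 * m * k ^ 2 - n t * g * k
            = (n t * g - 4 * m * k) ^ 2 / (8 * m) := by field_simp; ring
        have h4 : 0 ≤ (n t * g - 4 * m * k) ^ 2 / (8 * m) := by positivity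
        linarith
      have h7 := mul_le_mul_of_nonneg_right h6 hr
      have h8 := mul_le_mul_of_nonneg_left h5 (by positivity : 0 ≤ 2 * m)
      have e : n t ^ 2 * (1 / x) / (8 * m) * g ^ 2 = n t ^ 2 / (8 * m) * g ^ 2 * (1 / x) := by ring
      rw [e]
      linarith
    linarith
  have hsum := Finset.sum_le_sum fun t (_ : t ∈ Finset.range T) => step t
  refine hsum.trans ?_
  rw [Finset.sum_add_distrib, Finset.sum_add_distrib, Finset.sum_sub_distrib,
    Finset.sum_add_distrib, Finset.sum_range_sub', ← Finset.mul_sum, ← Finset.mul_sum]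
  have h1 := h.sum_sq_mul_decrease_le hD₁ T
  have h2 := mul_le_mul_of_nonneg_left (h.accU.sum_div_le_log T)
    (by positivity : 0 ≤ 2 * c ^ 2 / ε)
  have h3 := mul_le_mul_of_nonneg_left (h.accV.sum_div_le_log T) (by positivity : 0 ≤ L * η / 2)
  have h4 : 0 ≤ F T / η := div_nonneg (h.F_nonneg T) hη.le
  have h5 : 0 ≤ 2 * (D₀ + c ^ 2) * (1 / √(v T)) := by positivity
  have h6 : 2 * (D₀ + c ^ 2) * (1 / √(v 0)) = 2 * (D₀ + c ^ 2) / ε := by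
    rw [h.accV.zero, Real.sqrt_sq hε.le]; ring
  linarith

end Trajectory

end LightSAM

/-! ### Expectations along a random trajectory on a finite space -/

namespace LightSAM

/-- A random trajectory on a finite probability space whose stochastic gradients are conditionally
unbiased with affine variance during the first `T` iterations. -/
structure RandomTrajectory {Ω : Type*} [MeasurableSpace Ω] (μ : Measure Ω) (c ε η L D₀ D₁ f₀ n₀ : ℝ) (T : ℕ)
    (F n ip S G u v : ℕ → Ω → ℝ) : Prop where
  traj : ∀ ω, Trajectory c ε η L (F · ω) (n · ω) (ip · ω) (S · ω) (G · ω) (u · ω) (v · ω)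
  F_zero : ∀ ω, F 0 ω = f₀
  n_zero : ∀ ω, n 0 ω = n₀
  D₀_pos : 0 < D₀
  D₁_pos : 0 < D₁
  n_sq_le : ∀ t < T, ∀ ω, n t ω ^ 2 ≤ D₀ + D₁ * n t ω ^ 2
  integral_ip : ∀ t < T, ∀ k : ℝ → ℝ,
    ∫ ω, ip t ω * k (v t ω) ∂μ = ∫ ω, n t ω ^ 2 * k (v t ω) ∂μ
  integral_S_sq : ∀ t < T, ∀ k : ℝ → ℝ → ℝ → ℝ, (∀ x y z, 0 ≤ k x y z) →
    ∫ ω, k (n t ω) (u t ω) (v t ω) * S t ω ^ 2 ∂μ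
      ≤ ∫ ω, k (n t ω) (u t ω) (v t ω) * (D₀ + D₁ * n t ω ^ 2) ∂μ

section Finite

variable {Ω : Type*} [MeasurableSpace Ω] [Finite Ω] [MeasurableSingletonClass Ω]
  {μ : Measure Ω} [IsProbabilityMeasure μ]

theorem integral_mono_of_finite {f g : Ω → ℝ} (h : ∀ ω, f ω ≤ g ω) :
    ∫ ω, f ω ∂μ ≤ ∫ ω, g ω ∂μ :=
  integral_mono .of_finite .of_finite h

/-- Cauchy–Schwarz: `Aθ² - 2Nθ + H` is nonnegative pointwise, so its integral has nonpositive
discriminant in `θ`. -/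
theorem sq_integral_le_mul {N A H : Ω → ℝ} (hA : ∀ ω, 0 ≤ A ω) (hH : ∀ ω, 0 ≤ H ω)
    (h : ∀ ω, N ω ^ 2 ≤ A ω * H ω) :
    (∫ ω, N ω ∂μ) ^ 2 ≤ (∫ ω, A ω ∂μ) * ∫ ω, H ω ∂μ := by
  have key : ∀ θ : ℝ, 0 ≤ (∫ ω, A ω ∂μ) * (θ * θ) + (-2 * ∫ ω, N ω ∂μ) * θ + ∫ ω, H ω ∂μ := by
    intro θ
    have h1 : 0 ≤ ∫ ω, (A ω * (θ * θ) + N ω * (-2 * θ) + H ω) ∂μ := by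
      refine integral_nonneg fun ω => ?_
      have h2 := h ω
      have a0 := hA ω
      have h0 := hH ω
      simp only [Pi.zero_apply]
      rcases a0.eq_or_lt with a0 | a0
      · rw [← a0] at h2 ⊢
        have : N ω = 0 := by nlinarith
        rw [this]; linarith
      · have : 0 ≤ A ω * (A ω * (θ * θ) + N ω * (-2 * θ) + H ω) := by
          nlinarith [sq_nonneg (A ω * θ - N ω)]
        exact nonneg_of_mul_nonneg_right this a0
    rw [integral_add .of_finite .of_finite, integral_add .of_finite .of_finite,
      integral_mul_const, integral_mul_const] at h1
    linarith
  have := discrim_le_zero key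
  rw [discrim] at this
  linarith

theorem integral_sqrt_le {f : Ω → ℝ} {X : ℝ} (hX : 0 < X) (hf : ∀ ω, 0 ≤ f ω)
    (h : ∫ ω, f ω ∂μ ≤ X ^ 2) : ∫ ω, √(f ω) ∂μ ≤ X := by
  have h1 := sq_integral_le_mul (μ := μ) (N := fun ω => √(f ω)) (A := f) (H := fun _ => 1) hf
    (fun _ => zero_le_one) (fun ω => by rw [Real.sq_sqrt (hf ω), mul_one])
  simp only [integral_const, probReal_univ, smul_eq_mul, mul_one] at h1
  exact (abs_le_of_sq_le_sq' (h1.trans h) hX.le).2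

/-- Jensen's inequality for the logarithm of `√f`, through the tangent line at `Y`; only the mean of
`√f` is needed. -/
theorem integral_log_le {f : Ω → ℝ} {ε Y : ℝ} (hε : 0 < ε) (hY : 0 < Y) (hf : ∀ ω, 0 < f ω)
    (h : ∫ ω, √(f ω) ∂μ ≤ Y) : ∫ ω, Real.log (f ω / ε ^ 2) ∂μ ≤ 2 * Real.log (Y / ε) := by
  have h1 : ∀ ω, Real.log (f ω / ε ^ 2) ≤ 2 / Y * √(f ω) + (2 * Real.log (Y / ε) - 2) := by
    intro ω
    have hs := Real.sqrt_pos.2 (hf ω)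
    have e : f ω / ε ^ 2 = (√(f ω) / Y * (Y / ε)) ^ 2 := by
      rw [mul_pow, div_pow, div_pow, Real.sq_sqrt (hf ω).le]
      field_simp
    rw [e, Real.log_pow, Real.log_mul (div_pos hs hY).ne' (div_pos hY hε).ne']
    have := Real.log_le_sub_one_of_pos (div_pos hs hY)
    have e2 : 2 / Y * √(f ω) = 2 * (√(f ω) / Y) := by ring
    push_cast
    linarith
  refine (integral_mono_of_finite h1).trans ?_
  rw [integral_add .of_finite .of_finite, integral_const_mul]
  simp only [integral_const, probReal_univ, smul_eq_mul, one_mul]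
  have := mul_le_mul_of_nonneg_left h (by positivity : 0 ≤ 2 / Y)
  have e : 2 / Y * Y = 2 := by field_simp
  linarith

end Finite

namespace RandomTrajectory

variable {Ω : Type*} [MeasurableSpace Ω] [Finite Ω] [MeasurableSingletonClass Ω]
  {μ : Measure Ω} [IsProbabilityMeasure μ] {c ε η L D₀ D₁ f₀ n₀ : ℝ} {T : ℕ}
  {F n ip S G u v : ℕ → Ω → ℝ} (h : RandomTrajectory μ c ε η L D₀ D₁ f₀ n₀ T F n ip S G u v)
include h

/-- In the expectation of `sum_le`, unbiasedness turns `ip` into `n²`, and affine variance bounds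
the last subtracted term by `n²/(4√v)`; of `n²/√v` a share `1 - 1/4 - 1/4` survives. -/
theorem integral_sum_le :
    ∫ ω, ∑ t ∈ Finset.range T, n t ω ^ 2 * (1 / √(v t ω)) ∂μ
      ≤ 2 * (f₀ / η + 2 * (D₀ + c ^ 2) / ε + 2 * D₁ * n₀ ^ 2 / ε + 64 * D₁ ^ 2 * η ^ 2 * L ^ 2 / ε
        + 2 * c ^ 2 / ε * (∫ ω, Real.log (u T ω / ε ^ 2) ∂μ)
        + L * η / 2 * ∫ ω, Real.log (v T ω / ε ^ 2) ∂μ) := by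
  have h1 := integral_mono_of_finite (μ := μ) fun ω => (h.traj ω).sum_le h.D₀_pos h.D₁_pos T
  simp only [h.F_zero, h.n_zero] at h1
  rw [integral_add .of_finite .of_finite, integral_add .of_finite .of_finite,
    integral_const_mul, integral_const_mul, integral_finsetSum _ fun _ _ => .of_finite] at h1
  simp only [integral_const, probReal_univ, smul_eq_mul, one_mul] at h1
  rw [integral_finsetSum _ fun _ _ => .of_finite]
  have h2 : ∀ t ∈ Finset.range T, (1 / 2 : ℝ) * ∫ ω, n t ω ^ 2 * (1 / √(v t ω)) ∂μ
      ≤ ∫ ω, (ip t ω * (1 / √(v t ω)) - n t ω ^ 2 * (1 / √(v t ω)) / 4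
        - n t ω ^ 2 * (1 / √(v t ω)) / (4 * (D₀ + c ^ 2 + D₁ * n t ω ^ 2))
          * (S t ω ^ 2 + c ^ 2)) ∂μ := by
    intro t ht
    have ht := Finset.mem_range.1 ht
    have hD₀ := h.D₀_pos
    have hD₁ := h.D₁_pos
    have k1 := h.integral_ip t ht fun z => 1 / √z
    have k2 := h.integral_S_sq t ht
      (fun x _ z => x ^ 2 * (1 / √z) / (4 * (D₀ + c ^ 2 + D₁ * x ^ 2)))
      (fun x _ z => by positivity)
    have k3 : ∫ ω, n t ω ^ 2 * (1 / √(v t ω)) / 4 ∂μ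
        = ∫ ω, (n t ω ^ 2 * (1 / √(v t ω)) / (4 * (D₀ + c ^ 2 + D₁ * n t ω ^ 2))
            * (D₀ + D₁ * n t ω ^ 2)
          + n t ω ^ 2 * (1 / √(v t ω)) / (4 * (D₀ + c ^ 2 + D₁ * n t ω ^ 2)) * c ^ 2) ∂μ := by
      congr 1
      ext ω
      have : 0 < D₀ + c ^ 2 + D₁ * n t ω ^ 2 := by positivity
      rw [← mul_add, show D₀ + D₁ * n t ω ^ 2 + c ^ 2 = D₀ + c ^ 2 + D₁ * n t ω ^ 2 by ring]
      generalize D₀ + c ^ 2 + D₁ * n t ω ^ 2 = m at *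
      generalize 1 / √(v t ω) = r
      field_simp
    have k4 : ∫ ω, n t ω ^ 2 * (1 / √(v t ω)) / 4 ∂μ
        = (∫ ω, n t ω ^ 2 * (1 / √(v t ω)) ∂μ) / 4 := integral_div _ _
    rw [integral_add .of_finite .of_finite] at k3
    rw [integral_sub .of_finite .of_finite, integral_sub .of_finite .of_finite]
    simp only [mul_add (_ / _)]
    rw [integral_add .of_finite .of_finite]
    linarith
  have h3 := Finset.sum_le_sum h2
  rw [← Finset.mul_sum] at h3
  linarith

theorem integral_sum_le_of_le {Y : ℝ} (hY : 0 < Y) (hu : ∫ ω, √(u T ω) ∂μ ≤ Y) :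
    2 * √(1 + c / ε) * ∫ ω, ∑ t ∈ Finset.range T, n t ω ^ 2 * (1 / √(v t ω)) ∂μ
      ≤ √(1 + c / ε) * (4 * f₀ / η + 8 * (D₀ + c ^ 2) / ε + 8 * D₁ * n₀ ^ 2 / ε
        + 256 * D₁ ^ 2 * η ^ 2 * L ^ 2 / ε + 4 * L * η * Real.log (1 + c / ε)
        + (16 * c ^ 2 / ε + 4 * L * η) * Real.log (Y / ε)) := by
  obtain ⟨ω₀⟩ : Nonempty Ω := nonempty_of_isProbabilityMeasure μ
  have hε := (h.traj ω₀).accU.pos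
  have hη := (h.traj ω₀).η_pos
  have hL := (h.traj ω₀).L_nonneg
  have hc := (h.traj ω₀).c_nonneg
  have hk : 0 < 1 + c / ε := by positivity
  have h1 := h.integral_sum_le
  have h2 := integral_log_le (μ := μ) hε hY (fun ω => (h.traj ω).accU.acc_pos T) hu
  have h3 : ∫ ω, Real.log (v T ω / ε ^ 2) ∂μ
      ≤ 2 * Real.log (1 + c / ε) + ∫ ω, Real.log (u T ω / ε ^ 2) ∂μ := by
    have e : ∫ ω, (2 * Real.log (1 + c / ε) + Real.log (u T ω / ε ^ 2)) ∂μ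
        = 2 * Real.log (1 + c / ε) + ∫ ω, Real.log (u T ω / ε ^ 2) ∂μ := by
      rw [integral_add .of_finite .of_finite]
      simp
    rw [← e]
    refine integral_mono_of_finite fun ω => ?_
    have hu0 := (h.traj ω).accU.acc_pos T
    have hv0 := (h.traj ω).accV.acc_pos T
    have e2 : 2 * Real.log (1 + c / ε) + Real.log (u T ω / ε ^ 2)
        = Real.log ((1 + c / ε) ^ 2 * u T ω / ε ^ 2) := by
      rw [mul_div_assoc, Real.log_mul (by positivity) (by positivity), Real.log_pow]
      norm_num
    rw [e2]
    gcongr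
    exact (h.traj ω).v_le T
  have h4 := mul_le_mul_of_nonneg_left h2 (by positivity : 0 ≤ 2 * c ^ 2 / ε)
  have h5 := mul_le_mul_of_nonneg_left (h3.trans (add_le_add_right h2 _))
    (by positivity : 0 ≤ L * η / 2)
  rw [mul_comm 2, mul_assoc]
  refine mul_le_mul_of_nonneg_left ?_ (Real.sqrt_nonneg _)
  refine (mul_le_mul_of_nonneg_left (h1.trans (mul_le_mul_of_nonneg_left
    (add_le_add (add_le_add_right h4 _) h5) zero_le_two)) zero_le_two).trans (le_of_eq ?_)
  ring

/-- Cauchy–Schwarz twice: over the `T` indices, and over the sample space after writing `n² ≤ (n²/√v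
t) √v T`, as `v` increases. -/
theorem sq_sum_integral_le :
    (∑ t ∈ Finset.range T, ∫ ω, n t ω ∂μ) ^ 2
      ≤ T * ((∫ ω, ∑ t ∈ Finset.range T, n t ω ^ 2 * (1 / √(v t ω)) ∂μ) * ∫ ω, √(v T ω) ∂μ) := by
  rw [← integral_finsetSum _ fun _ _ => .of_finite, ← mul_assoc, ← integral_const_mul (T : ℝ)]
  refine sq_integral_le_mul (μ := μ) (fun ω => ?_) (fun ω => Real.sqrt_nonneg _) fun ω => ?_
  · exact mul_nonneg T.cast_nonneg (Finset.sum_nonneg fun t _ => by positivity)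
  · have h1 := sq_sum_le_card_mul_sum_sq (s := Finset.range T) (f := fun t => n t ω)
    rw [Finset.card_range] at h1
    refine h1.trans ?_
    rw [mul_assoc]
    refine mul_le_mul_of_nonneg_left ?_ T.cast_nonneg
    rw [Finset.sum_mul]
    refine Finset.sum_le_sum fun t ht => ?_
    have hv := (h.traj ω).accV.sqrt_pos t
    have h2 := Real.sqrt_le_sqrt ((h.traj ω).accV.mono (Finset.mem_range.1 ht).le)
    rw [mul_assoc, one_div_mul_eq_div]
    exact le_mul_of_one_le_right (sq_nonneg _) ((one_le_div hv).2 h2)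

open Classical in
-- `u T` is split according to whether `D₁n²` exceeds `D₀`. The small part has mean at most `2D₀T +
-- ε²`. In the large part each `S²` is divided by `max √(u t) c`, and `sqrt_v_le_max` exchanges this
-- denominator for `√v`; the maximum is there to make that possible.
theorem integral_max_sqrt_le :
    ∫ ω, max √(u T ω) c ∂μ ≤ √(2 * D₀ * T + ε ^ 2) + (if ε < c then c else 0)
      + 2 * D₁ * (2 * √(1 + c / ε)
        * ∫ ω, ∑ t ∈ Finset.range T, n t ω ^ 2 * (1 / √(v t ω)) ∂μ) := by
  obtain ⟨ω₀⟩ : Nonempty Ω := nonempty_of_isProbabilityMeasure μ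
  have hε := (h.traj ω₀).accU.pos
  have hc := (h.traj ω₀).c_nonneg
  have hD₀ := h.D₀_pos
  have hD₁ := h.D₁_pos
  set big : ℝ → ℝ := fun x => if D₀ < D₁ * x ^ 2 then 1 else 0 with hbig
  have big_nonneg : ∀ x, 0 ≤ big x := fun x => by simp only [hbig]; split_ifs <;> norm_num
  have big_le : ∀ x, big x ≤ 1 := fun x => by simp only [hbig]; split_ifs <;> norm_num
  have hpt : ∀ ω, max √(u T ω) c
      ≤ √(ε ^ 2 + ∑ t ∈ Finset.range T, (1 - big (n t ω)) * S t ω ^ 2) + (if ε < c then c else 0)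
        + ∑ t ∈ Finset.range T, big (n t ω) / max √(u t ω) c * S t ω ^ 2 := by
    intro ω
    have hpos : ∀ t, 0 < max √(u t ω) c :=
      fun t => ((h.traj ω).accU.sqrt_pos t).trans_le (le_max_left _ _)
    have hs2 : 0 ≤ ∑ t ∈ Finset.range T, big (n t ω) / max √(u t ω) c * S t ω ^ 2 :=
      Finset.sum_nonneg fun t _ =>
        mul_nonneg (div_nonneg (big_nonneg _) (hpos t).le) (sq_nonneg _)
    have hle := (h.traj ω).accU.le_sqrt T
    have hif : 0 ≤ if ε < c then c else 0 := by split_ifs <;> linarith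
    -- If `√u` is below `c`, the maximum is `c` itself, and `ε ≤ √u` shows that this requires `ε <
    -- c`. Otherwise `u T` is divided by `√(u T)`.
    rcases lt_or_ge √(u T ω) c with hlt | hge
    · rw [max_eq_right hlt.le, if_pos (hle.trans_lt hlt)]
      linarith [Real.sqrt_nonneg (ε ^ 2 + ∑ t ∈ Finset.range T, (1 - big (n t ω)) * S t ω ^ 2)]
    · rw [max_eq_left hge]
      have hu := (h.traj ω).accU.sqrt_pos T
      have hA : 0 ≤ ∑ t ∈ Finset.range T, (1 - big (n t ω)) * S t ω ^ 2 :=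
        Finset.sum_nonneg fun t _ => mul_nonneg (by linarith [big_le (n t ω)]) (sq_nonneg _)
      set A := ∑ t ∈ Finset.range T, (1 - big (n t ω)) * S t ω ^ 2 with hAdef
      have h1 : u T ω = ε ^ 2 + A + ∑ t ∈ Finset.range T, big (n t ω) * S t ω ^ 2 := by
        rw [hAdef, add_assoc, ← Finset.sum_add_distrib, (h.traj ω).accU.eq_add_sum T]
        congr 1
        exact Finset.sum_congr rfl fun t _ => by ring
      have h2 : ∑ t ∈ Finset.range T, big (n t ω) * S t ω ^ 2
          ≤ √(u T ω) * ∑ t ∈ Finset.range T, big (n t ω) / max √(u t ω) c * S t ω ^ 2 := by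
        rw [Finset.mul_sum]
        refine Finset.sum_le_sum fun t ht => ?_
        have h3 : max √(u t ω) c ≤ √(u T ω) :=
          max_le (Real.sqrt_le_sqrt ((h.traj ω).accU.mono (Finset.mem_range.1 ht).le)) hge
        rw [← mul_assoc]
        refine mul_le_mul_of_nonneg_right ?_ (sq_nonneg _)
        rw [mul_div_assoc', le_div_iff₀ (hpos t), mul_comm]
        exact mul_le_mul_of_nonneg_right h3 (big_nonneg _)
      have h4 := (h.traj ω).accU.sq_sqrt T
      have h5 : √(ε ^ 2 + A) ≤ √(u T ω) := by
        apply Real.sqrt_le_sqrt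
        have : 0 ≤ ∑ t ∈ Finset.range T, big (n t ω) * S t ω ^ 2 :=
          Finset.sum_nonneg fun t _ => mul_nonneg (big_nonneg _) (sq_nonneg _)
        linarith
      have h6 := Real.sq_sqrt (by positivity : 0 ≤ ε ^ 2 + A)
      have h7 : √(u T ω) * √(u T ω) ≤ √(u T ω) * (√(ε ^ 2 + A)
          + ∑ t ∈ Finset.range T, big (n t ω) / max √(u t ω) c * S t ω ^ 2) := by
        nlinarith [Real.sqrt_nonneg (ε ^ 2 + A)]
      linarith [le_of_mul_le_mul_left h7 hu]
  refine (integral_mono_of_finite hpt).trans ?_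
  rw [integral_add .of_finite .of_finite, integral_add .of_finite .of_finite]
  simp only [integral_const, probReal_univ, smul_eq_mul, one_mul]
  have hX : 0 < 2 * D₀ * T + ε ^ 2 := by positivity
  have hsmall : ∫ ω, √(ε ^ 2 + ∑ t ∈ Finset.range T, (1 - big (n t ω)) * S t ω ^ 2) ∂μ
      ≤ √(2 * D₀ * T + ε ^ 2) := by
    refine integral_sqrt_le (Real.sqrt_pos.2 hX) (fun ω => ?_) ?_
    · exact add_nonneg (sq_nonneg _) (Finset.sum_nonneg fun t _ =>
        mul_nonneg (by linarith [big_le (n t ω)]) (sq_nonneg _))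
    · rw [Real.sq_sqrt hX.le, integral_add .of_finite .of_finite,
        integral_finsetSum _ fun _ _ => .of_finite]
      simp only [integral_const, probReal_univ, smul_eq_mul, one_mul]
      have : ∑ t ∈ Finset.range T, ∫ ω, (1 - big (n t ω)) * S t ω ^ 2 ∂μ
          ≤ ∑ t ∈ Finset.range T, 2 * D₀ := by
        refine Finset.sum_le_sum fun t ht => ?_
        refine (h.integral_S_sq t (Finset.mem_range.1 ht) (fun x _ _ => 1 - big x)
          (fun x _ _ => by linarith [big_le x])).trans ?_
        have e : ∫ _ω : Ω, 2 * D₀ ∂μ = 2 * D₀ := by simp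
        rw [← e]
        refine integral_mono_of_finite fun ω => ?_
        simp only [hbig]
        split_ifs with hb
        · rw [sub_self, zero_mul]; positivity
        · linarith
      rw [Finset.sum_const, Finset.card_range, nsmul_eq_mul] at this
      linarith
  have hlarge : ∫ ω, ∑ t ∈ Finset.range T, big (n t ω) / max √(u t ω) c * S t ω ^ 2 ∂μ
      ≤ 2 * D₁ * (2 * √(1 + c / ε)
        * ∫ ω, ∑ t ∈ Finset.range T, n t ω ^ 2 * (1 / √(v t ω)) ∂μ) := by
    rw [integral_finsetSum _ fun _ _ => .of_finite, integral_finsetSum _ fun _ _ => .of_finite,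
      ← mul_assoc, Finset.mul_sum]
    refine Finset.sum_le_sum fun t ht => ?_
    refine (h.integral_S_sq t (Finset.mem_range.1 ht) (fun x y _ => big x / max √y c)
      (fun x y _ => div_nonneg (big_nonneg x) (le_max_of_le_right hc))).trans ?_
    rw [← integral_const_mul]
    refine integral_mono_of_finite fun ω => ?_
    have hv := (h.traj ω).accV.sqrt_pos t
    have hw : 0 < max √(u t ω) c := ((h.traj ω).accU.sqrt_pos t).trans_le (le_max_left _ _)
    have h1 : 1 / max √(u t ω) c ≤ 2 * √(1 + c / ε) * (1 / √(v t ω)) := by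
      rw [mul_one_div, div_le_div_iff₀ hw hv, one_mul]
      exact (h.traj ω).sqrt_v_le_max t
    simp only [hbig]
    split_ifs with hb
    · calc 1 / max √(u t ω) c * (D₀ + D₁ * n t ω ^ 2)
          ≤ 2 * √(1 + c / ε) * (1 / √(v t ω)) * (2 * D₁ * n t ω ^ 2) := by
            gcongr
            linarith
        _ = _ := by ring
    · rw [zero_div, zero_mul]
      positivity
  linarith

theorem integral_u_le (hD : D₁ < 1 / 2) : ∫ ω, u T ω ∂μ ≤ 2 * D₀ * T + ε ^ 2 := by
  have e : ∀ ω, u T ω = ε ^ 2 + ∑ t ∈ Finset.range T, S t ω ^ 2 :=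
    fun ω => (h.traj ω).accU.eq_add_sum T
  simp only [e]
  rw [integral_add .of_finite .of_finite, integral_finsetSum _ fun _ _ => .of_finite]
  simp only [integral_const, probReal_univ, smul_eq_mul, one_mul]
  have : ∑ t ∈ Finset.range T, ∫ ω, S t ω ^ 2 ∂μ ≤ ∑ t ∈ Finset.range T, 2 * D₀ := by
    refine Finset.sum_le_sum fun t ht => ?_
    have h1 := h.integral_S_sq t (Finset.mem_range.1 ht) (fun _ _ _ => 1) (fun _ _ _ => zero_le_one)
    simp only [one_mul] at h1
    refine h1.trans ?_
    have e : ∫ _ω : Ω, 2 * D₀ ∂μ = 2 * D₀ := by simp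
    rw [← e]
    refine integral_mono_of_finite fun ω => ?_
    nlinarith [h.n_sq_le t (Finset.mem_range.1 ht) ω, h.D₁_pos, sq_nonneg (n t ω)]
  rw [Finset.sum_const, Finset.card_range, nsmul_eq_mul] at this
  linarith

theorem sq_sum_integral_le_of_lt_half (hD : D₁ < 1 / 2) :
    (∑ t ∈ Finset.range T, ∫ ω, n t ω ∂μ) ^ 2 ≤ T * (2 * D₀ * T) := by
  have h1 : ∀ t ∈ Finset.range T, (∫ ω, n t ω ∂μ) ^ 2 ≤ 2 * D₀ := fun t ht => by
    have h2 := sq_integral_le_mul (μ := μ) (N := n t) (A := fun _ => 2 * D₀) (H := fun _ => 1)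
      (fun _ => by linarith [h.D₀_pos]) (fun _ => zero_le_one) (fun ω => by
        nlinarith [h.n_sq_le t (Finset.mem_range.1 ht) ω, h.D₁_pos, sq_nonneg (n t ω)])
    simpa using h2
  have h2 := sq_sum_le_card_mul_sum_sq (s := Finset.range T) (f := fun t => ∫ ω, n t ω ∂μ)
  have h3 := Finset.sum_le_sum h1
  rw [Finset.sum_const, Finset.card_range, nsmul_eq_mul] at h3
  rw [Finset.card_range] at h2
  exact h2.trans (mul_le_mul_of_nonneg_left (by linarith) T.cast_nonneg)

/-- Going through `sqrt_v_le_max` would require the mean of `max √u c`. Instead Jensen's inequality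
is applied to both terms of `sqrt_v_le`, and `add_mul_sqrt_log_le` is used at the deterministic `X`.
-/
theorem integral_sqrt_v_le_of_lt_half (hT : 0 < T) (hD : D₁ < 1 / 2)
    (hcX : c ≤ √(2 * D₀ * T + ε ^ 2)) :
    ∫ ω, √(v T ω) ∂μ ≤ 2 * √(1 + c / ε) * √(2 * D₀ * T + ε ^ 2) := by
  obtain ⟨ω₀⟩ : Nonempty Ω := nonempty_of_isProbabilityMeasure μ
  have hε := (h.traj ω₀).accU.pos
  have hc := (h.traj ω₀).c_nonneg
  have hD₀ := h.D₀_pos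
  have hT' : (0 : ℝ) < T := by exact_mod_cast hT
  set X := √(2 * D₀ * T + ε ^ 2) with hX
  have hεX : ε < X := Real.lt_sqrt_of_sq_lt (by nlinarith [mul_pos hD₀ hT'])
  have hX0 : 0 < X := hε.trans hεX
  have hu : ∫ ω, √(u T ω) ∂μ ≤ X := by
    refine integral_sqrt_le hX0 (fun ω => ((h.traj ω).accU.acc_pos T).le) ?_
    rw [hX, Real.sq_sqrt (by positivity)]
    exact h.integral_u_le hD
  have hlog := integral_log_le (μ := μ) hε hX0 (fun ω => (h.traj ω).accU.acc_pos T) hu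
  have hK : 0 < Real.log (X ^ 2 / ε ^ 2) := by
    apply Real.log_pos
    rw [one_lt_div (by positivity)]
    nlinarith
  have e : 2 * Real.log (X / ε) = Real.log (X ^ 2 / ε ^ 2) := by
    rw [← div_pow, Real.log_pow]
    norm_num
  have hsl : ∫ ω, √(Real.log (u T ω / ε ^ 2)) ∂μ ≤ √(Real.log (X ^ 2 / ε ^ 2)) := by
    refine integral_sqrt_le (Real.sqrt_pos.2 hK) (fun ω => Real.log_nonneg ?_) ?_
    · rw [one_le_div (by positivity)]
      exact (h.traj ω).accU.sq_le T
    · rw [Real.sq_sqrt hK.le, ← e]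
      exact hlog
  refine (integral_mono_of_finite fun ω => (h.traj ω).sqrt_v_le T).trans ?_
  rw [integral_add .of_finite .of_finite, integral_const_mul]
  exact (add_le_add hu (mul_le_mul_of_nonneg_left hsl hc)).trans
    (add_mul_sqrt_log_le hε hc hεX.le hcX)

open Classical in
-- Packages the estimates as a coupled pair, with `g` equal to `2κΓ` plus a slack. `Y` is the mean
-- of `max √u c` if `D₁ ≥ 1/2`, and `√(2D₀T + ε²)` if `D₁ < 1/2`.
theorem exists_bound (hT : 0 < T) :
    ∃ Y g : ℝ, ε ≤ Y ∧ 0 ≤ g ∧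
      g ≤ √(1 + c / ε) * (4 * f₀ / η + 8 * (D₀ + c ^ 2) / ε + 8 * D₁ * n₀ ^ 2 / ε
        + 256 * D₁ ^ 2 * η ^ 2 * L ^ 2 / ε + 4 * L * η * Real.log (1 + c / ε)
        + (16 * c ^ 2 / ε + 4 * L * η) * Real.log (Y / ε)) + 48 * √(1 + c / ε) * c ^ 2 / ε ∧
      Y ≤ √(2 * D₀ * T + ε ^ 2) + 2 * D₁ * g ∧
      (∑ t ∈ Finset.range T, ∫ ω, n t ω ∂μ) ^ 2 ≤ T * (g * Y) ∧
      (D₁ < 1 / 2 → Y = √(2 * D₀ * T + ε ^ 2) ∧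
        (∑ t ∈ Finset.range T, ∫ ω, n t ω ∂μ) ^ 2 ≤ T * Y ^ 2) := by
  obtain ⟨ω₀⟩ : Nonempty Ω := nonempty_of_isProbabilityMeasure μ
  have hε := (h.traj ω₀).accU.pos
  have hc := (h.traj ω₀).c_nonneg
  have hD₀ := h.D₀_pos
  have hD₁ := h.D₁_pos
  have hk : 1 ≤ √(1 + c / ε) := Real.one_le_sqrt.2 (by linarith [div_nonneg hc hε.le])
  have hX2 : 0 < 2 * D₀ * T + ε ^ 2 := by positivity
  have hsq := h.sq_sum_integral_le
  have hmax := h.integral_max_sqrt_le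
  have hG : 0 ≤ ∫ ω, ∑ t ∈ Finset.range T, n t ω ^ 2 * (1 / √(v t ω)) ∂μ :=
    integral_nonneg fun ω => Finset.sum_nonneg fun t _ => by positivity
  have hgY := fun Y => h.integral_sum_le_of_le (Y := Y)
  set Γ := ∫ ω, ∑ t ∈ Finset.range T, n t ω ^ 2 * (1 / √(v t ω)) ∂μ
  set κ := √(1 + c / ε)
  -- The slack pays for the stray `c`: when `c > ε`, already `c²/ε` exceeds `c`. `le_mainPart` has
  -- room for the factor 48.
  have hslack : c ≤ ε ∨ c ≤ 48 * κ * c ^ 2 / ε := by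
    refine or_iff_not_imp_left.2 fun hlt => ?_
    rw [le_div_iff₀ hε]
    have : c ^ 2 ≤ κ * c ^ 2 := le_mul_of_one_le_left (sq_nonneg c) hk
    nlinarith [not_le.1 hlt]
  have hs0 : 0 ≤ 48 * κ * c ^ 2 / ε := by positivity
  have hΓ0 : 0 ≤ 2 * κ * Γ := by positivity
  rcases lt_or_ge D₁ (1 / 2) with hD | hD
  · set X := √(2 * D₀ * T + ε ^ 2) with hX
    have hεX : ε ≤ X := Real.le_sqrt_of_sq_le (by nlinarith [mul_nonneg hD₀.le T.cast_nonneg])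
    have hX0 : 0 < X := hε.trans_le hεX
    have hu : ∫ ω, √(u T ω) ∂μ ≤ X := by
      refine integral_sqrt_le hX0 (fun ω => ((h.traj ω).accU.acc_pos T).le) ?_
      rw [hX, Real.sq_sqrt hX2.le]
      exact h.integral_u_le hD
    have hW : (∑ t ∈ Finset.range T, ∫ ω, n t ω ∂μ) ^ 2 ≤ T * X ^ 2 := by
      refine (h.sq_sum_integral_le_of_lt_half hD).trans
        (mul_le_mul_of_nonneg_left ?_ T.cast_nonneg)
      rw [hX, Real.sq_sqrt hX2.le]
      nlinarith
    refine ⟨X, 2 * κ * Γ + 48 * κ * c ^ 2 / ε, hεX, by positivity,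
      add_le_add_left (hgY X hX0 hu) _, ?_, ?_, fun _ => ⟨rfl, hW⟩⟩
    · have : 0 ≤ 2 * D₁ * (2 * κ * Γ + 48 * κ * c ^ 2 / ε) := by positivity
      linarith
    · rcases le_or_gt c X with hcX | hcX
      · have hV := h.integral_sqrt_v_le_of_lt_half hT hD hcX
        refine hsq.trans (mul_le_mul_of_nonneg_left ?_ T.cast_nonneg)
        have := mul_le_mul_of_nonneg_left hV hG
        nlinarith
      -- Here `c > X ≥ ε`, so the slack alone makes `g ≥ c > X`.
      · refine hW.trans (mul_le_mul_of_nonneg_left ?_ T.cast_nonneg)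
        have := hslack.resolve_left (by linarith)
        nlinarith
  · set Y := ∫ ω, max √(u T ω) c ∂μ
    have hu : ∫ ω, √(u T ω) ∂μ ≤ Y := integral_mono_of_finite fun ω => le_max_left _ _
    have hεY : ε ≤ Y := by
      have e : ∫ _ω : Ω, ε ∂μ = ε := by simp
      rw [← e]
      exact integral_mono_of_finite fun ω => ((h.traj ω).accU.le_sqrt T).trans (le_max_left _ _)
    have hV : ∫ ω, √(v T ω) ∂μ ≤ 2 * κ * Y := by
      rw [← integral_const_mul]
      exact integral_mono_of_finite fun ω => (h.traj ω).sqrt_v_le_max T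
    refine ⟨Y, 2 * κ * Γ + 48 * κ * c ^ 2 / ε, hεY, by positivity,
      add_le_add_left (hgY Y (hε.trans_le hεY) hu) _, ?_, ?_, fun hlt => absurd hlt hD.not_gt⟩
    · have : (if ε < c then c else 0) ≤ 48 * κ * c ^ 2 / ε := by
        split_ifs with hlt
        · exact hslack.resolve_left hlt.not_ge
        · exact hs0
      nlinarith
    · refine hsq.trans (mul_le_mul_of_nonneg_left ?_ T.cast_nonneg)
      have := mul_le_mul_of_nonneg_left hV hG
      nlinarith [mul_nonneg hs0 (hε.le.trans hεY)]

end RandomTrajectory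

end LightSAM

/-! ### LightSAM-I as a random trajectory -/

namespace LightSAM

open scoped RealInnerProductSpace

variable {d n b : ℕ} {ℓ : Fin n → Vec d → ℝ} {ρ η ε L D₀ D₁ : ℝ} {x₁ : Vec d}

theorem run_congr {B B' : ℕ → (Fin b → Fin n)} {t : ℕ} (h : ∀ k < t, B k = B' k) :
    run ℓ ρ η ε x₁ B t = run ℓ ρ η ε x₁ B' t := by
  induction t with
  | zero => rfl
  | succ t ih => rw [run, run, ih fun k hk => h k (hk.trans t.lt_succ_self), h t t.lt_succ_self]

/-- The gradient `s` used in the perturbation of iteration `t + 1`. -/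
def perturbGrad (ℓ : Fin n → Vec d → ℝ) (ρ η ε : ℝ) (x₁ : Vec d) (B : ℕ → (Fin b → Fin n))
    (t : ℕ) : Vec d :=
  gradient (batchLoss ℓ (B t)) (run ℓ ρ η ε x₁ B t).x

/-- The gradient `g` used in the descent step of iteration `t + 1`. -/
def stepGrad (ℓ : Fin n → Vec d → ℝ) (ρ η ε : ℝ) (x₁ : Vec d) (B : ℕ → (Fin b → Fin n))
    (t : ℕ) : Vec d :=
  gradient (batchLoss ℓ (B t)) (perturb ρ (run ℓ ρ η ε x₁ B t).u (run ℓ ρ η ε x₁ B t).x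
    (perturbGrad ℓ ρ η ε x₁ B t))

theorem norm_perturb_sub (hρ : 0 ≤ ρ) (u : ℝ) (x s : Vec d) :
    ‖perturb ρ u x s - x‖ = ρ * (‖s‖ / √(u + ‖s‖ ^ 2)) := by
  rw [perturb, add_sub_cancel_left, norm_smul, Real.norm_of_nonneg (by positivity)]
  ring

theorem trajectory (hn : 0 < n) (hb : 0 < b) (hρ : 0 < ρ) (hη : 0 < η) (hε : 0 < ε) (hL : 0 ≤ L)
    (hpos : ∀ x, 0 ≤ fullLoss ℓ x) (hsmooth : IsSmooth ℓ L) (B : ℕ → (Fin b → Fin n)) :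
    Trajectory (ρ * L) ε η L (fun t => fullLoss ℓ (run ℓ ρ η ε x₁ B t).x)
      (fun t => ‖gradient (fullLoss ℓ) (run ℓ ρ η ε x₁ B t).x‖)
      (fun t => ⟪gradient (fullLoss ℓ) (run ℓ ρ η ε x₁ B t).x, perturbGrad ℓ ρ η ε x₁ B t⟫)
      (fun t => ‖perturbGrad ℓ ρ η ε x₁ B t‖) (fun t => ‖stepGrad ℓ ρ η ε x₁ B t‖)
      (fun t => (run ℓ ρ η ε x₁ B t).u) (fun t => (run ℓ ρ η ε x₁ B t).v) := by
  have accU : Accumulates ε (fun t => ‖perturbGrad ℓ ρ η ε x₁ B t‖)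
      (fun t => (run ℓ ρ η ε x₁ B t).u) := ⟨hε, rfl, fun _ => rfl⟩
  have accV : Accumulates ε (fun t => ‖stepGrad ℓ ρ η ε x₁ B t‖)
      (fun t => (run ℓ ρ η ε x₁ B t).v) := ⟨hε, rfl, fun _ => rfl⟩
  have hx : ∀ t, (run ℓ ρ η ε x₁ B (t + 1)).x = (run ℓ ρ η ε x₁ B t).x
      + (-(η / √(run ℓ ρ η ε x₁ B (t + 1)).v)) • stepGrad ℓ ρ η ε x₁ B t := fun t => by
    rw [neg_smul, ← sub_eq_add_neg]
    rfl
  have herr : ∀ t, ‖stepGrad ℓ ρ η ε x₁ B t - perturbGrad ℓ ρ η ε x₁ B t‖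
      ≤ ρ * L * (‖perturbGrad ℓ ρ η ε x₁ B t‖ / √(run ℓ ρ η ε x₁ B (t + 1)).u) := fun t => by
    have h1 := lipschitz_gradient_batchLoss hb hsmooth (B t)
      (perturb ρ (run ℓ ρ η ε x₁ B t).u (run ℓ ρ η ε x₁ B t).x (perturbGrad ℓ ρ η ε x₁ B t))
      (run ℓ ρ η ε x₁ B t).x
    rw [norm_perturb_sub hρ.le] at h1
    refine h1.trans (le_of_eq ?_)
    rw [accU.succ t]
    ring
  refine ⟨accU, accV, by positivity, hη, hL, fun t => hpos _, fun t => norm_nonneg _,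
    fun t => norm_nonneg _, fun t => norm_nonneg _, fun t => ?_, fun t => ?_, fun t => ?_⟩
  · have := norm_sub_norm_le (stepGrad ℓ ρ η ε x₁ B t) (perturbGrad ℓ ρ η ε x₁ B t)
    linarith [herr t]
  · have h1 := lipschitz_gradient_fullLoss hn hsmooth (run ℓ ρ η ε x₁ B (t + 1)).x
      (run ℓ ρ η ε x₁ B t).x
    have h2 := norm_sub_norm_le (gradient (fullLoss ℓ) (run ℓ ρ η ε x₁ B (t + 1)).x)
      (gradient (fullLoss ℓ) (run ℓ ρ η ε x₁ B t).x)
    have h3 : ‖(run ℓ ρ η ε x₁ B (t + 1)).x - (run ℓ ρ η ε x₁ B t).x‖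
        = η * (‖stepGrad ℓ ρ η ε x₁ B t‖ / √(run ℓ ρ η ε x₁ B (t + 1)).v) := by
      rw [hx, add_sub_cancel_left, norm_smul, norm_neg, Real.norm_of_nonneg (by positivity)]
      ring
    rw [h3] at h1
    linarith
  · have h1 := le_quadratic_of_lipschitz_gradient (differentiable_fullLoss hsmooth)
      (lipschitz_gradient_fullLoss hn hsmooth) (run ℓ ρ η ε x₁ B t).x
      ((-(η / √(run ℓ ρ η ε x₁ B (t + 1)).v)) • stepGrad ℓ ρ η ε x₁ B t)
    rw [← hx, norm_smul, norm_neg, Real.norm_of_nonneg (by positivity), inner_smul_right] at h1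
    have hv := accV.sqrt_pos t
    have hle := accV.inv_sqrt_succ_le t
    have h2 : L / 2 * (η / √(run ℓ ρ η ε x₁ B (t + 1)).v * ‖stepGrad ℓ ρ η ε x₁ B t‖) ^ 2
        = L * η ^ 2 / 2 * (‖stepGrad ℓ ρ η ε x₁ B t‖ ^ 2 / (run ℓ ρ η ε x₁ B (t + 1)).v) := by
      rw [mul_pow, div_pow, accV.sq_sqrt (t + 1)]
      ring
    rw [h2] at h1
    have h3 := herr t
    have h4 := real_inner_le_norm (gradient (fullLoss ℓ) (run ℓ ρ η ε x₁ B t).x)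
      (stepGrad ℓ ρ η ε x₁ B t)
    have h5 := abs_le.1 (abs_real_inner_le_norm (gradient (fullLoss ℓ) (run ℓ ρ η ε x₁ B t).x)
      (stepGrad ℓ ρ η ε x₁ B t - perturbGrad ℓ ρ η ε x₁ B t)) |>.1
    rw [inner_sub_right] at h5
    have h6 := mul_le_mul_of_nonneg_left h3
      (norm_nonneg (gradient (fullLoss ℓ) (run ℓ ρ η ε x₁ B t).x))
    have hr : 0 ≤ 1 / √(run ℓ ρ η ε x₁ B t).v := by positivity
    have h7 := mul_le_mul_of_nonneg_right h4 (sub_nonneg.2 hle)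
    have h8 := mul_le_mul_of_nonneg_right (h5.trans' (neg_le_neg h6)) hr
    rw [div_eq_mul_one_div η] at h1
    have h9 := mul_le_mul_of_nonneg_left (add_le_add h7 h8) hη.le
    linarith

/-- The minibatches of the first `T` iterations. -/
def batches {Ω : Type*} (ξ : ℕ → Ω → (Fin b → Fin n)) (T : ℕ) (ω : Ω)
    (i : Finset.range T) : Fin b → Fin n :=
  ξ i ω

open Classical in
/-- An infinite sequence of minibatches that starts with the given ones. -/
def extend [Nonempty (Fin b → Fin n)] {T : ℕ} (a : Finset.range T → (Fin b → Fin n)) (k : ℕ) :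
    Fin b → Fin n :=
  if h : k ∈ Finset.range T then a ⟨k, h⟩ else Classical.arbitrary _

theorem extend_batches {Ω : Type*} {ξ : ℕ → Ω → (Fin b → Fin n)}
    [Nonempty (Fin b → Fin n)] {T k : ℕ} (hk : k < T) (ω : Ω) :
    extend (batches ξ T ω) k = ξ k ω := by
  rw [extend, dif_pos (Finset.mem_range.2 hk)]
  rfl

theorem run_extend_batches {Ω : Type*} {ξ : ℕ → Ω → (Fin b → Fin n)}
    [Nonempty (Fin b → Fin n)] {T t : ℕ} (ht : t ≤ T) (ω : Ω) :
    run ℓ ρ η ε x₁ (extend (batches ξ T ω)) t = run ℓ ρ η ε x₁ (fun k => ξ k ω) t :=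
  run_congr fun _ hk => extend_batches (hk.trans_le ht) ω

section Sampling

variable {Ω : Type*} [MeasurableSpace Ω] {μ : Measure Ω}
  {ξ : ℕ → Ω → (Fin b → Fin n)}

theorem integral_comp_of_finite {α : Type*} [MeasurableSpace α] [Finite α]
    [MeasurableSingletonClass α] {Y : Ω → α} (hY : Measurable Y) (ψ : α → ℝ) :
    ∫ a, ψ a ∂(μ.map Y) = ∫ ω, ψ (Y ω) ∂μ :=
  integral_map hY.aemeasurable (measurable_of_finite ψ).aestronglyMeasurable

theorem IsMinibatchSampling.measurable_batches (h : IsMinibatchSampling μ ξ) (T : ℕ) :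
    Measurable (batches ξ T) :=
  measurable_pi_lambda _ fun i => h.measurable i

variable [IsProbabilityMeasure μ]

theorem integrable_comp_of_finite {α : Type*} [MeasurableSpace α] [Finite α]
    [MeasurableSingletonClass α] {Y : Ω → α} (hY : Measurable Y) (ψ : α → ℝ) :
    Integrable (fun ω => ψ (Y ω)) μ := by
  have : IsProbabilityMeasure (μ.map Y) := Measure.isProbabilityMeasure_map hY.aemeasurable
  exact (Integrable.of_finite (μ := μ.map Y) (f := ψ)).comp_measurable hY

/-- The minibatch of an iteration may be averaged over independently of the current state. -/
theorem IsMinibatchSampling.integral_run (h : IsMinibatchSampling μ ξ) (t : ℕ)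
    (Φ : (Fin b → Fin n) → State d → ℝ) :
    ∫ ω, Φ (ξ t ω) (run ℓ ρ η ε x₁ (fun k => ξ k ω) t) ∂μ
      = ∫ ω, ∫ ω', Φ (ξ t ω') (run ℓ ρ η ε x₁ (fun k => ξ k ω) t) ∂μ ∂μ := by
  obtain ⟨ω₀⟩ : Nonempty Ω := nonempty_of_isProbabilityMeasure μ
  have : Nonempty (Fin b → Fin n) := ⟨ξ 0 ω₀⟩
  have hm := h.measurable_batches t
  -- The state after `t` iterations is a function of `batches ξ t`, so independence and Fubini's
  -- theorem give the claim.
  have hindep : IndepFun (batches ξ t) (ξ t) μ := by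
    have h1 := h.indep.indepFun_finset (Finset.range t) {t} (by simp) h.measurable
    exact h1.comp measurable_id (measurable_pi_apply (⟨t, Finset.mem_singleton_self t⟩ :
      ({t} : Finset ℕ)))
  have hprod := (indepFun_iff_map_prod_eq_prod_map_map hm.aemeasurable
    (h.measurable t).aemeasurable).1 hindep
  have p1 : IsProbabilityMeasure (μ.map (batches ξ t)) :=
    Measure.isProbabilityMeasure_map hm.aemeasurable
  have p2 : IsProbabilityMeasure (μ.map (ξ t)) :=
    Measure.isProbabilityMeasure_map (h.measurable t).aemeasurable
  simp only [← run_extend_batches (T := t) le_rfl]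
  have e1 := integral_comp_of_finite (μ := μ) (hm.prodMk (h.measurable t))
    (fun z => Φ z.2 (run ℓ ρ η ε x₁ (extend z.1) t))
  rw [hprod, integral_prod _ .of_finite] at e1
  rw [← e1]
  refine Eq.trans ?_ (integral_comp_of_finite (μ := μ) hm
    (fun a => ∫ ω', Φ (ξ t ω') (run ℓ ρ η ε x₁ (extend a) t) ∂μ))
  congr 1
  ext a
  exact integral_comp_of_finite (h.measurable t) _

theorem IsMinibatchSampling.integral_member (h : IsMinibatchSampling μ ξ) (t : ℕ) (j : Fin b)
    (ψ : Fin n → ℝ) : ∫ ω, ψ (ξ t ω j) ∂μ = 1 / (n : ℝ) * ∑ i, ψ i := by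
  have hm : Measurable fun ω => ξ t ω j := (measurable_pi_apply j).comp (h.measurable t)
  have : IsProbabilityMeasure (μ.map fun ω => ξ t ω j) :=
    Measure.isProbabilityMeasure_map hm.aemeasurable
  rw [← integral_comp_of_finite hm ψ, integral_fintype .of_finite, Finset.mul_sum]
  refine Finset.sum_congr rfl fun i _ => ?_
  rw [map_measureReal_apply hm (MeasurableSet.singleton i), ← h.uniform t j i]
  rfl

theorem IsMinibatchSampling.integral_inner_gradient (h : IsMinibatchSampling μ ξ) (hb : 0 < b)
    (hsmooth : IsSmooth ℓ L) (t : ℕ) (x y : Vec d) :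
    ∫ ω, ⟪y, gradient (batchLoss ℓ (ξ t ω)) x⟫ ∂μ = ⟪y, gradient (fullLoss ℓ) x⟫ := by
  have hb' : (b : ℝ) ≠ 0 := by exact_mod_cast hb.ne'
  simp only [gradient_batchLoss hsmooth, gradient_fullLoss hsmooth, inner_smul_right, inner_sum]
  rw [integral_const_mul, integral_finsetSum _ fun j _ =>
    integrable_comp_of_finite (h.measurable t) (fun B => ⟪y, gradient (ℓ (B j)) x⟫)]
  simp only [h.integral_member t _ fun i => ⟪y, gradient (ℓ i) x⟫]
  rw [Finset.sum_const, Finset.card_univ, Fintype.card_fin, nsmul_eq_mul]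
  field_simp

/-- Jensen's inequality for the unbiased minibatch gradient. Together with affine variance it bounds
the full gradient when `D₁ < 1`. -/
theorem IsMinibatchSampling.sq_norm_gradient_le (h : IsMinibatchSampling μ ξ) (hb : 0 < b)
    (hsmooth : IsSmooth ℓ L) (t : ℕ) (x : Vec d) :
    ‖gradient (fullLoss ℓ) x‖ ^ 2 ≤ ∫ ω, ‖gradient (batchLoss ℓ (ξ t ω)) x‖ ^ 2 ∂μ := by
  set y := gradient (fullLoss ℓ) x with hy
  have h1 := h.integral_inner_gradient hb hsmooth t x y
  rw [← hy, real_inner_self_eq_norm_sq] at h1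
  have i1 := integrable_comp_of_finite (μ := μ) (h.measurable t)
    fun B => ⟪y, gradient (batchLoss ℓ B) x⟫
  have i2 := integrable_comp_of_finite (μ := μ) (h.measurable t)
    fun B => ‖gradient (batchLoss ℓ B) x‖ ^ 2
  have h2 : ∫ ω, ⟪y, gradient (batchLoss ℓ (ξ t ω)) x⟫ ∂μ
      ≤ ∫ ω, (‖y‖ ^ 2 / 2 + ‖gradient (batchLoss ℓ (ξ t ω)) x‖ ^ 2 / 2) ∂μ := by
    refine integral_mono i1 ((integrable_const _).add (i2.div_const 2)) fun ω => ?_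
    have := real_inner_le_norm y (gradient (batchLoss ℓ (ξ t ω)) x)
    simp only
    nlinarith [sq_nonneg (‖y‖ - ‖gradient (batchLoss ℓ (ξ t ω)) x‖)]
  rw [h1, integral_add (integrable_const _) (i2.div_const 2)] at h2
  simp only [integral_const, probReal_univ, smul_eq_mul, one_mul] at h2
  have h3 := integral_div (μ := μ) (2 : ℝ) fun ω => ‖gradient (batchLoss ℓ (ξ t ω)) x‖ ^ 2
  linarith

theorem IsMinibatchSampling.integrable_run (h : IsMinibatchSampling μ ξ) (t : ℕ)
    (ψ : State d → ℝ) : Integrable (fun ω => ψ (run ℓ ρ η ε x₁ (fun k => ξ k ω) t)) μ := by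
  obtain ⟨ω₀⟩ : Nonempty Ω := nonempty_of_isProbabilityMeasure μ
  have : Nonempty (Fin b → Fin n) := ⟨ξ 0 ω₀⟩
  simp only [← run_extend_batches (T := t) le_rfl]
  exact integrable_comp_of_finite (h.measurable_batches t)
    (fun a => ψ (run ℓ ρ η ε x₁ (extend a) t))

theorem IsMinibatchSampling.randomTrajectory (h : IsMinibatchSampling μ ξ) [Nonempty (Fin b → Fin n)]
    (hn : 0 < n) (hb : 0 < b) (hρ : 0 < ρ) (hη : 0 < η) (hε : 0 < ε) (hL : 0 ≤ L) (hD₀ : 0 < D₀)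
    (hD₁ : 0 < D₁) (hpos : ∀ x, 0 ≤ fullLoss ℓ x) (hsmooth : IsSmooth ℓ L)
    (hvar : AffineVariance μ ℓ ξ D₀ D₁) (T : ℕ) :
    RandomTrajectory (μ.map (batches ξ T)) (ρ * L) ε η L D₀ D₁ (fullLoss ℓ x₁)
      ‖gradient (fullLoss ℓ) x₁‖ T
      (fun t a => fullLoss ℓ (run ℓ ρ η ε x₁ (extend a) t).x)
      (fun t a => ‖gradient (fullLoss ℓ) (run ℓ ρ η ε x₁ (extend a) t).x‖)
      (fun t a => ⟪gradient (fullLoss ℓ) (run ℓ ρ η ε x₁ (extend a) t).x,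
        perturbGrad ℓ ρ η ε x₁ (extend a) t⟫)
      (fun t a => ‖perturbGrad ℓ ρ η ε x₁ (extend a) t‖)
      (fun t a => ‖stepGrad ℓ ρ η ε x₁ (extend a) t‖)
      (fun t a => (run ℓ ρ η ε x₁ (extend a) t).u)
      (fun t a => (run ℓ ρ η ε x₁ (extend a) t).v) where
  traj a := trajectory hn hb hρ hη hε hL hpos hsmooth (extend a)
  F_zero _ := rfl
  n_zero _ := rfl
  D₀_pos := hD₀
  D₁_pos := hD₁
  n_sq_le t _ a := (h.sq_norm_gradient_le hb hsmooth t _).trans (hvar t _)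
  integral_ip t ht k := by
    simp only [perturbGrad]
    rw [integral_comp_of_finite (h.measurable_batches T),
      integral_comp_of_finite (h.measurable_batches T)]
    simp only [run_extend_batches (ξ := ξ) ht.le, extend_batches (ξ := ξ) ht]
    rw [h.integral_run t fun B s =>
      ⟪gradient (fullLoss ℓ) s.x, gradient (batchLoss ℓ B) s.x⟫ * k s.v]
    congr 1
    ext ω
    rw [integral_mul_const, h.integral_inner_gradient hb hsmooth, real_inner_self_eq_norm_sq]
  integral_S_sq t ht k hk := by
    simp only [perturbGrad]
    rw [integral_comp_of_finite (h.measurable_batches T),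
      integral_comp_of_finite (h.measurable_batches T)]
    simp only [run_extend_batches (ξ := ξ) ht.le, extend_batches (ξ := ξ) ht]
    rw [h.integral_run t fun B s => k ‖gradient (fullLoss ℓ) s.x‖ s.u s.v
      * ‖gradient (batchLoss ℓ B) s.x‖ ^ 2]
    refine integral_mono
      (h.integrable_run t fun s => ∫ ω', k ‖gradient (fullLoss ℓ) s.x‖ s.u s.v
        * ‖gradient (batchLoss ℓ (ξ t ω')) s.x‖ ^ 2 ∂μ)
      (h.integrable_run t fun s => k ‖gradient (fullLoss ℓ) s.x‖ s.u s.v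
        * (D₀ + D₁ * ‖gradient (fullLoss ℓ) s.x‖ ^ 2)) fun ω => ?_
    simp only
    rw [integral_const_mul]
    exact mul_le_mul_of_nonneg_left (hvar t _) (hk _ _ _)

end Sampling

end LightSAM

/-! ### Decoupling and comparison of constants -/

namespace LightSAM

/-- The tangent line of the logarithm at `2k`, together with `2k ≤ e (k + e)`. -/
theorem mul_log_le_half_add {k y : ℝ} (hk : 0 ≤ k) (hy : 0 < y) :
    k * Real.log y ≤ y / 2 + k * Real.log (k + Real.exp 1) := by
  rcases hk.eq_or_lt with rfl | hk
  · rw [zero_mul, zero_mul]; linarith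
  have he : (2 : ℝ) ≤ Real.exp 1 := by linarith [Real.add_one_le_exp (1 : ℝ)]
  have h1 := Real.log_le_sub_one_of_pos (div_pos hy (mul_pos two_pos hk))
  rw [Real.log_div hy.ne' (by positivity)] at h1
  have h2 : Real.log (2 * k) ≤ Real.log (k + Real.exp 1) + 1 := by
    rw [← Real.log_exp 1, ← Real.log_mul (by positivity) (by positivity), Real.log_exp]
    apply Real.log_le_log (by positivity)
    nlinarith
  have h3 : Real.log y ≤ y / (2 * k) + Real.log (k + Real.exp 1) := by linarith
  refine (mul_le_mul_of_nonneg_left h3 hk.le).trans (le_of_eq ?_)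
  field_simp

theorem one_le_log_add_exp {k : ℝ} (hk : 0 ≤ k) : 1 ≤ Real.log (k + Real.exp 1) := by
  have := Real.log_le_log (Real.exp_pos 1) (le_add_of_nonneg_left hk)
  rwa [Real.log_exp] at this

/-- Decoupling of a bound `g ≲ log Y`, `Y ≲ g`; `q` stands for `log Y` or its positive part. -/
theorem mul_le_of_coupled {A₃ A₄ A₅ A₆ D₁ X Y g H q : ℝ} (hA₄ : 0 ≤ A₄) (hA₅ : 0 ≤ A₅)
    (hA₆ : 0 < A₆) (hD₁ : 0 < D₁) (hH : 0 ≤ H) (hY : 0 < Y) (hg₀ : 0 ≤ g)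
    (hA₆' : A₆ = 2 * X + 4 * D₁ * A₃ + 8 * D₁ * A₅ * Real.log (4 * D₁ * A₅ + Real.exp 1))
    (hg : g ≤ A₃ + 2 * A₅ * q + A₄ * H) (hYg : Y ≤ X + 2 * D₁ * g)
    (hq : q ≤ Real.log Y ∨ q ≤ 0 ∧ 1 ≤ A₆) :
    Y ≤ A₆ + 4 * D₁ * A₄ * H ∧
    g * Y ≤ A₆ * (A₃ + 2 * A₅ * Real.log A₆)
      + (2 * A₄ * A₆ + 16 * D₁ * A₄ * A₅ + 8 * D₁ * A₄ * (A₃ + 2 * A₅ * Real.log A₆)) / 2 * H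
      + 8 * D₁ * A₄ * (2 * A₄ + 16 * D₁ * A₄ * A₅ / A₆) / 4 * H ^ 2 := by
  have hk : 0 ≤ 4 * D₁ * A₅ := by positivity
  have hqk : 4 * D₁ * A₅ * q
      ≤ Y / 2 + 4 * D₁ * A₅ * Real.log (4 * D₁ * A₅ + Real.exp 1) := by
    rcases hq with hq | ⟨hq, -⟩
    · exact (mul_le_mul_of_nonneg_left hq hk).trans (mul_log_le_half_add hk hY)
    · have h1 := mul_nonneg hk (zero_le_one.trans (one_le_log_add_exp hk))
      have h2 := mul_nonpos_of_nonneg_of_nonpos hk hq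
      linarith
  -- The term `Y / 2` from `hqk` is absorbed on the left, which doubles the other terms and produces
  -- `A₆`.
  have hY' : Y ≤ A₆ + 4 * D₁ * A₄ * H := by
    have := mul_le_mul_of_nonneg_left hg (by linarith : 0 ≤ 2 * D₁)
    nlinarith
  have hE : 0 ≤ 4 * D₁ * A₄ * H := by positivity
  -- The tangent line of the logarithm at `A₆`, now that `Y` is bounded.
  have hqlog : q ≤ Real.log A₆ + 4 * D₁ * A₄ * H / A₆ := by
    rcases hq with hq | ⟨hq, h1⟩
    · have h1 := Real.log_le_sub_one_of_pos (div_pos hY hA₆)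
      rw [Real.log_div hY.ne' hA₆.ne'] at h1
      have h2 : Y / A₆ ≤ 1 + 4 * D₁ * A₄ * H / A₆ := by
        rw [← div_self hA₆.ne', ← add_div]
        exact div_le_div_of_nonneg_right hY' hA₆.le
      linarith
    · have h2 := Real.log_nonneg h1
      have h3 := div_nonneg hE hA₆.le
      linarith
  refine ⟨hY', ?_⟩
  have hg' : g ≤ (A₃ + 2 * A₅ * Real.log A₆) + 2 * A₅ * (4 * D₁ * A₄ * H / A₆) + A₄ * H := by
    have := mul_le_mul_of_nonneg_left hqlog (by linarith : 0 ≤ 2 * A₅)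
    linarith
  refine (mul_le_mul hg' hY' hY.le (hg₀.trans hg')).trans (le_of_eq ?_)
  field_simp
  ring

namespace Params

variable {p : Params}

theorem one_le_D₂ : 1 ≤ p.D₂ := (le_max_left _ _).trans (le_max_left _ _)

theorem four_mul_le_D₂ : 4 * p.D₁ ≤ p.D₂ := (le_max_right _ _).trans (le_max_left _ _)

/-- The conditions on the parameters under which the bound is established. -/
structure Valid (p : Params) : Prop where
  ρ_pos : 0 < p.ρ
  η_pos : 0 < p.η
  ε_pos : 0 < p.ε
  L_nonneg : 0 ≤ p.L
  D₀_pos : 0 < p.D₀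
  D₁_pos : 0 < p.D₁
  fx₁_nonneg : 0 ≤ p.fx₁
  gx₁_nonneg : 0 ≤ p.gx₁
  gx₁_le : p.gx₁ ≤ p.gŵ₁ + p.ρ * p.L
  fw₁_nonneg : 0 ≤ p.fw₁

/-- The common factor `√(ρL/ε + 1)` of `A₃`, `A₄` and `A₅`. -/
def κ (p : Params) : ℝ := √(p.ρ * p.L / p.ε + 1)

/-- The part of `A₃ / κ` that does not contain `log ε`. -/
def mainPart (p : Params) : ℝ :=
  4 * p.fx₁ / p.η + 8 * (p.D₀ + 4 * p.ρ ^ 2 * p.L ^ 2) / p.ε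
    + 16 * p.D₁ * (p.gŵ₁ ^ 2 / p.ε + 4 * (1 + 2 * p.D₂) * p.L ^ 2 / p.ε * p.η ^ 2)
    + 8 * (2 * p.ρ ^ 2 * p.L + p.ρ * p.D₀ / (2 * p.ε * √p.D₁) + p.ρ * p.gx₁
      + (p.D₀ + 4 * p.ρ ^ 2 * p.L ^ 2) * p.η / p.ε + p.fw₁) / p.η
    + (4 * p.η * p.L * (3 + p.ρ * p.L) + 8) * Real.log (1 + p.ρ * p.L / p.ε)

/-- The coefficient of `-log ε` in `A₃ / κ`. -/
def logPart (p : Params) : ℝ :=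
  16 * p.D₁ * (4 * (1 + 2 * p.D₂) * p.L ^ 2 / p.ε * (4 * p.ρ ^ 2))
    + 8 * (12 * p.ρ ^ 2 * p.η * p.L ^ 2 / p.ε + p.η + p.ρ
        + (1 + p.ρ * p.L) * (2 * p.η ^ 2 * p.L + 8 * p.ρ ^ 2 * p.L)) / p.η
    + (80 * p.ρ ^ 2 * p.L ^ 2 / p.ε + 4 * p.η * p.L)

theorem A₃_eq : p.A₃ = p.κ * (p.mainPart - p.logPart * Real.log p.ε) := by
  simp only [A₃, A₂, A₁, mainPart, logPart, κ]
  ring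

/-- Needed when `ε > 1`: it measures how far the term `-log ε` lowers `A₃`. -/
theorem κ_mul_logPart (hη : 0 < p.η) :
    p.κ * p.logPart = 2 * p.A₅ + 2 * p.A₄ - p.κ * (4 * p.η * p.L + 8) := by
  simp only [A₄, A₅, logPart, κ]
  field_simp
  ring

theorem bracket_eq (p : Params) (T : ℕ) : p.bracket T
    = 2 * (p.A₆ T * (p.A₃ + 2 * p.A₅ * Real.log (p.A₆ T)))
      + 2 * p.A₇ T * Real.log (p.A₇ T + Real.exp 1)
      + 64 * (8 * p.D₁ * p.A₄ * (2 * p.A₄ + 16 * p.D₁ * p.A₄ * p.A₅ / p.A₆ T)) ^ 2 + 1 := by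
  rw [bracket]
  ring

namespace Valid

variable (h : p.Valid)
include h

theorem one_le_κ : 1 ≤ p.κ := by
  have := h.ρ_pos; have := h.ε_pos; have := h.L_nonneg
  exact Real.one_le_sqrt.2 (le_add_of_nonneg_left (by positivity))

theorem eight_mul_κ_le_A₅ : 8 * p.κ ≤ p.A₅ := by
  have := h.ρ_pos; have := h.ε_pos; have := h.L_nonneg; have := h.η_pos
  rw [A₅, mul_comm]
  refine mul_le_mul_of_nonneg_left (le_add_of_nonneg_left ?_) (Real.sqrt_nonneg _)
  positivity

theorem A₅_pos : 0 < p.A₅ := by linarith [h.one_le_κ, h.eight_mul_κ_le_A₅]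

theorem A₄_nonneg : 0 ≤ p.A₄ := by
  have := h.ρ_pos; have := h.ε_pos; have := h.L_nonneg; have := h.D₁_pos
  have := zero_le_one.trans p.one_le_D₂
  rw [A₄]
  positivity

theorem log_nonneg : 0 ≤ Real.log (1 + p.ρ * p.L / p.ε) := by
  have := h.ρ_pos; have := h.ε_pos; have := h.L_nonneg
  exact Real.log_nonneg (le_add_of_nonneg_right (by positivity))

theorem mainPart_nonneg : 0 ≤ p.mainPart := by
  have := h.ρ_pos; have := h.ε_pos; have := h.L_nonneg; have := h.D₁_pos; have := h.D₀_pos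
  have := h.η_pos; have := h.fx₁_nonneg; have := h.gx₁_nonneg; have := h.fw₁_nonneg
  have := h.log_nonneg
  have := zero_le_one.trans p.one_le_D₂
  rw [mainPart]
  positivity

theorem le_logPart : 16 * (p.ρ * p.L) ^ 2 / p.ε + 4 * p.L * p.η ≤ p.logPart := by
  have := h.ρ_pos; have := h.ε_pos; have := h.L_nonneg; have := h.D₁_pos; have := h.η_pos
  have := zero_le_one.trans p.one_le_D₂
  have h1 : p.logPart - (16 * (p.ρ * p.L) ^ 2 / p.ε + 4 * p.L * p.η)
      = 16 * p.D₁ * (4 * (1 + 2 * p.D₂) * p.L ^ 2 / p.ε * (4 * p.ρ ^ 2))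
    + 8 * (12 * p.ρ ^ 2 * p.η * p.L ^ 2 / p.ε + p.η + p.ρ
        + (1 + p.ρ * p.L) * (2 * p.η ^ 2 * p.L + 8 * p.ρ ^ 2 * p.L)) / p.η
    + 64 * p.ρ ^ 2 * p.L ^ 2 / p.ε := by
    rw [logPart]; ring
  rw [← sub_nonneg, h1]
  positivity

theorem le_A₅ : p.κ * (16 * (p.ρ * p.L) ^ 2 / p.ε + 4 * p.L * p.η) ≤ 2 * p.A₅ := by
  have := h.ρ_pos; have := h.ε_pos; have := h.L_nonneg; have := h.η_pos
  have h1 : 2 * p.A₅ - p.κ * (16 * (p.ρ * p.L) ^ 2 / p.ε + 4 * p.L * p.η)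
      = p.κ * (64 * p.ρ ^ 2 * p.L ^ 2 / p.ε
      + 8 * p.ρ / p.η * (1 + 8 * p.ρ * p.L * (1 + p.ρ * p.L))
      + 4 * p.η * p.L * (5 + 4 * p.ρ * p.L) + 16) := by
    rw [A₅, κ]; ring
  have := h.one_le_κ
  rw [← sub_nonneg, h1]
  positivity

/-- `A₄` pays for passing from `‖∇f(x₁)‖` to `‖∇f(ŵ₁)‖`, and `D₂ ≥ 4D₁` for the term with `D₁²`. The
slack 48 fits because `D₀ + 4ρ²L²` occurs twice in `A₃`, directly and through `A₂`. -/
theorem le_mainPart : p.κ * (4 * p.fx₁ / p.η + 8 * (p.D₀ + (p.ρ * p.L) ^ 2) / p.ε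
    + 8 * p.D₁ * p.gx₁ ^ 2 / p.ε + 256 * p.D₁ ^ 2 * p.η ^ 2 * p.L ^ 2 / p.ε
    + 4 * p.L * p.η * Real.log (1 + p.ρ * p.L / p.ε)) + 48 * p.κ * (p.ρ * p.L) ^ 2 / p.ε
      ≤ p.κ * p.mainPart + p.A₄ := by
  have hρ := h.ρ_pos
  have hε := h.ε_pos
  have hL := h.L_nonneg
  have hD₁ := h.D₁_pos
  have hD₀ := h.D₀_pos
  have hη := h.η_pos
  have hf := h.fx₁_nonneg
  have hgx := h.gx₁_nonneg
  have hfw := h.fw₁_nonneg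
  have hlog := h.log_nonneg
  have hκ := h.one_le_κ
  have hD₂ := zero_le_one.trans p.one_le_D₂
  have h1 : 8 * p.D₁ * p.gx₁ ^ 2 / p.ε
      ≤ 16 * p.D₁ * (p.gŵ₁ ^ 2 / p.ε) + 16 * p.D₁ * (p.ρ * p.L) ^ 2 / p.ε := by
    have : p.gx₁ ^ 2 ≤ 2 * p.gŵ₁ ^ 2 + 2 * (p.ρ * p.L) ^ 2 := by
      have := pow_le_pow_left₀ hgx h.gx₁_le 2
      nlinarith [sq_nonneg (p.gŵ₁ - p.ρ * p.L)]
    calc 8 * p.D₁ * p.gx₁ ^ 2 / p.ε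
        ≤ 8 * p.D₁ * (2 * p.gŵ₁ ^ 2 + 2 * (p.ρ * p.L) ^ 2) / p.ε := by gcongr
      _ = _ := by ring
  have h2 : 256 * p.D₁ ^ 2 * p.η ^ 2 * p.L ^ 2 / p.ε
      ≤ 16 * p.D₁ * (4 * (1 + 2 * p.D₂) * p.L ^ 2 / p.ε * p.η ^ 2) := by
    calc 256 * p.D₁ ^ 2 * p.η ^ 2 * p.L ^ 2 / p.ε
        = 16 * p.D₁ * (4 * (4 * p.D₁) * p.L ^ 2 / p.ε * p.η ^ 2) := by ring
      _ ≤ _ := by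
        gcongr
        linarith [p.four_mul_le_D₂]
  have h3 : 8 * (p.D₀ + 4 * p.ρ ^ 2 * p.L ^ 2) / p.ε
      ≤ 8 * (2 * p.ρ ^ 2 * p.L + p.ρ * p.D₀ / (2 * p.ε * √p.D₁) + p.ρ * p.gx₁
      + (p.D₀ + 4 * p.ρ ^ 2 * p.L ^ 2) * p.η / p.ε + p.fw₁) / p.η := by
    rw [le_div_iff₀ hη]
    have e : 8 * (p.D₀ + 4 * p.ρ ^ 2 * p.L ^ 2) / p.ε * p.η
      = 8 * ((p.D₀ + 4 * p.ρ ^ 2 * p.L ^ 2) * p.η / p.ε) := by ring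
    have : 0 ≤ 2 * p.ρ ^ 2 * p.L + p.ρ * p.D₀ / (2 * p.ε * √p.D₁) + p.ρ * p.gx₁ := by positivity
    rw [e]
    linarith
  have h4 : 4 * p.L * p.η * Real.log (1 + p.ρ * p.L / p.ε)
      ≤ (4 * p.η * p.L * (3 + p.ρ * p.L) + 8) * Real.log (1 + p.ρ * p.L / p.ε) := by
    refine mul_le_mul_of_nonneg_right ?_ hlog
    have : 0 ≤ 4 * p.η * p.L * (2 + p.ρ * p.L) := by positivity
    linarith
  have h5 : 16 * p.D₁ * (p.ρ * p.L) ^ 2 / p.ε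
      ≤ 16 * (8 * (1 + 2 * p.D₂) * p.D₁ + 3) * p.ρ ^ 2 * p.L ^ 2 / p.ε := by
    rw [mul_pow, ← mul_assoc]
    gcongr
    nlinarith [mul_nonneg hD₂ hD₁.le]
  have h6 : 8 * (p.D₀ + (p.ρ * p.L) ^ 2) / p.ε + 48 * (p.ρ * p.L) ^ 2 / p.ε
      ≤ 8 * (p.D₀ + 4 * p.ρ ^ 2 * p.L ^ 2) / p.ε + 8 * (p.D₀ + 4 * p.ρ ^ 2 * p.L ^ 2) / p.ε := by
    rw [← add_div, ← add_div]
    refine div_le_div_of_nonneg_right ?_ hε.le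
    nlinarith [mul_nonneg (sq_nonneg p.ρ) (sq_nonneg p.L)]
  have e : p.A₄ = p.κ * (16 * (8 * (1 + 2 * p.D₂) * p.D₁ + 3) * p.ρ ^ 2 * p.L ^ 2 / p.ε) := rfl
  have e2 : 48 * p.κ * (p.ρ * p.L) ^ 2 / p.ε = p.κ * (48 * (p.ρ * p.L) ^ 2 / p.ε) := by ring
  rw [e, e2, ← mul_add, ← mul_add]
  refine mul_le_mul_of_nonneg_left ?_ (zero_le_one.trans hκ)
  rw [mainPart]
  linarith

theorem A₇_nonneg {T : ℕ} (hA₆ : 0 < p.A₆ T)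
    (hA : 0 ≤ p.A₃ + 2 * p.A₅ * Real.log (p.A₆ T)) : 0 ≤ p.A₇ T := by
  have := h.A₄_nonneg
  have := h.A₅_pos
  have := h.D₁_pos
  rw [A₇]
  positivity

theorem one_le_bracket {T : ℕ} (hA₆ : 0 < p.A₆ T)
    (hA : 0 ≤ p.A₃ + 2 * p.A₅ * Real.log (p.A₆ T)) : 1 ≤ p.bracket T := by
  have h7 := h.A₇_nonneg hA₆ hA
  have h1 := zero_le_one.trans (one_le_log_add_exp h7)
  rw [p.bracket_eq]
  refine le_add_of_nonneg_left ?_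
  positivity

theorem mul_le_bracket_of_le {T : ℕ} (hA₆ : 0 < p.A₆ T)
    (hA : 0 ≤ p.A₃ + 2 * p.A₅ * Real.log (p.A₆ T)) {Y g q : ℝ} (hY : 0 < Y) (hg₀ : 0 ≤ g)
    (hg : g ≤ p.A₃ + 2 * p.A₅ * q + p.A₄) (hYg : Y ≤ √(2 * p.D₀ * T + p.ε ^ 2) + 2 * p.D₁ * g)
    (hq : q ≤ Real.log Y ∨ q ≤ 0 ∧ 1 ≤ p.A₆ T) : g * Y ≤ p.bracket T := by
  have h4 := h.A₄_nonneg
  have h5 := h.A₅_pos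
  have hD := h.D₁_pos
  have h7 := h.A₇_nonneg hA₆ hA
  have h1 := one_le_log_add_exp h7
  have h2 := (mul_le_of_coupled h4 h5.le hA₆ hD zero_le_one hY hg₀ rfl
    (by rwa [mul_one]) hYg hq).2
  rw [p.bracket_eq]
  have e : p.A₇ T = 2 * p.A₄ * p.A₆ T + 16 * p.D₁ * p.A₄ * p.A₅
    + 8 * p.D₁ * p.A₄ * (p.A₃ + 2 * p.A₅ * Real.log (p.A₆ T)) := rfl
  rw [← e] at h2
  have hR : 0 ≤ 8 * p.D₁ * p.A₄ * (2 * p.A₄ + 16 * p.D₁ * p.A₄ * p.A₅ / p.A₆ T) := by positivity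
  generalize 8 * p.D₁ * p.A₄ * (2 * p.A₄ + 16 * p.D₁ * p.A₄ * p.A₅ / p.A₆ T) = R at *
  have hP := mul_nonneg hA₆.le hA
  nlinarith [mul_le_mul_of_nonneg_left h1 h7, sq_nonneg (16 * R - 1)]

/-- With `H = 1 + 2 log ε`, `A₇ H / 2` leaves at least `5A₇/2` of the bracket's logarithmic term
unused. Since `ε ≤ Y` forces `A₇` to be at least `32√ε/5`, this rest is at least `16√ε`, which
covers `H⁴/4096`. -/
theorem mul_le_bracket_of_le_log {T : ℕ} (hε : 1 < p.ε) (hA₄ : 4 ≤ p.A₄) (hA₆ : 0 < p.A₆ T)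
    (hA : 0 ≤ p.A₃ + 2 * p.A₅ * Real.log (p.A₆ T)) {Y g : ℝ} (hY : p.ε ≤ Y) (hg₀ : 0 ≤ g)
    (hg : g ≤ p.A₃ + 2 * p.A₅ * Real.log Y + p.A₄ * (1 + 2 * Real.log p.ε))
    (hYg : Y ≤ √(2 * p.D₀ * T + p.ε ^ 2) + 2 * p.D₁ * g) : g * Y ≤ p.bracket T := by
  have h4 := h.A₄_nonneg
  have h5 : 8 ≤ p.A₅ := by linarith [h.one_le_κ, h.eight_mul_κ_le_A₅]
  have h50 := h.A₅_pos
  have hD := h.D₁_pos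
  have h7 := h.A₇_nonneg hA₆ hA
  have hl := Real.log_pos hε
  obtain ⟨hY', h2⟩ := mul_le_of_coupled h4 h50.le hA₆ hD (by linarith)
    (h.ε_pos.trans_le hY) hg₀ rfl hg hYg (Or.inl le_rfl)
  have hP := mul_nonneg hA₆.le hA
  have e : p.A₇ T = 2 * p.A₄ * p.A₆ T + 16 * p.D₁ * p.A₄ * p.A₅
    + 8 * p.D₁ * p.A₄ * (p.A₃ + 2 * p.A₅ * Real.log (p.A₆ T)) := rfl
  rw [← e] at h2
  rw [p.bracket_eq]
  have hR : 0 ≤ 8 * p.D₁ * p.A₄ * (2 * p.A₄ + 16 * p.D₁ * p.A₄ * p.A₅ / p.A₆ T) := by positivity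
  have hDA : 0 ≤ p.D₁ * p.A₄ := by positivity
  have hA₇ : 8 * p.A₆ T + 128 * (p.D₁ * p.A₄) ≤ p.A₇ T := by
    have h8 : 0 ≤ 8 * p.D₁ * p.A₄ * (p.A₃ + 2 * p.A₅ * Real.log (p.A₆ T)) := by positivity
    rw [e]
    nlinarith [mul_le_mul_of_nonneg_right hA₄ hA₆.le, mul_le_mul_of_nonneg_left h5 hDA]
  generalize 8 * p.D₁ * p.A₄ * (2 * p.A₄ + 16 * p.D₁ * p.A₄ * p.A₅ / p.A₆ T) = R at *
  generalize p.A₇ T = A₇ at *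
  have hs := Real.exp_pos (Real.log p.ε / 2)
  have hs2 : Real.exp (Real.log p.ε / 2) ^ 2 = p.ε := by
    rw [← Real.exp_nat_mul, Nat.cast_ofNat, mul_div_cancel₀ _ two_ne_zero, Real.exp_log h.ε_pos]
  have hls := Real.add_one_le_exp (Real.log p.ε / 2)
  have hl8 := Real.add_one_le_exp (Real.log p.ε / 8)
  have hs8 : Real.exp (Real.log p.ε / 8) ^ 4 = Real.exp (Real.log p.ε / 2) := by
    rw [← Real.exp_nat_mul]
    congr 1
    push_cast
    ring
  have hH4 : (1 + 2 * Real.log p.ε) ^ 4 ≤ 65536 * Real.exp (Real.log p.ε / 2) := by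
    calc (1 + 2 * Real.log p.ε) ^ 4 ≤ (16 * Real.exp (Real.log p.ε / 8)) ^ 4 :=
          pow_le_pow_left₀ (by linarith) (by linarith) 4
      _ = _ := by rw [mul_pow, hs8]; norm_num
  have hεA : p.ε ≤ A₇ * (4 + (1 + 2 * Real.log p.ε)) / 32 := by
    have h8 := mul_le_mul_of_nonneg_right hA₇ (by linarith : 0 ≤ 1 + 2 * Real.log p.ε)
    nlinarith [mul_nonneg hA₆.le hl.le]
  have hA₇0 : 0 < A₇ := by nlinarith
  have hA₇s : 32 / 5 * Real.exp (Real.log p.ε / 2) ≤ A₇ := by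
    have h8 : 4 + (1 + 2 * Real.log p.ε) ≤ 5 * Real.exp (Real.log p.ε / 2) := by linarith
    have h9 := mul_le_mul_of_nonneg_left h8 h7
    have h10 : Real.exp (Real.log p.ε / 2) * (32 / 5 * Real.exp (Real.log p.ε / 2))
        ≤ Real.exp (Real.log p.ε / 2) * A₇ := by nlinarith
    exact le_of_mul_le_mul_left h10 hs
  have hlog : Real.log p.ε + 3 ≤ 2 * Real.log (A₇ + Real.exp 1) := by
    have h8 : Real.log (p.ε * Real.exp 3) ≤ Real.log (A₇ ^ 2) := by
      apply Real.log_le_log (mul_pos h.ε_pos (Real.exp_pos _))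
      have he : Real.exp 3 ≤ 27 := by
        have h9 := Real.exp_one_lt_d9
        have h10 : Real.exp 3 = Real.exp 1 ^ 3 := by rw [← Real.exp_nat_mul]; norm_num
        rw [h10]
        calc Real.exp 1 ^ 3 ≤ 3 ^ 3 := by gcongr; linarith
          _ = 27 := by norm_num
      have h9 := pow_le_pow_left₀ (by positivity) hA₇s 2
      rw [mul_pow, hs2] at h9
      nlinarith [mul_le_mul_of_nonneg_left he h.ε_pos.le]
    rw [Real.log_mul h.ε_pos.ne' (Real.exp_pos _).ne', Real.log_exp, Real.log_pow] at h8
    have h9 := Real.log_le_log hA₇0 (le_add_of_nonneg_right (Real.exp_pos 1).le)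
    push_cast at h8
    linarith
  have h8 := mul_le_mul_of_nonneg_left hlog h7
  -- Balanced so that the first term is exactly the one in the bracket and, by `hH4`, the second is
  -- at most `16√ε`.
  have h9 : R / 4 * (1 + 2 * Real.log p.ε) ^ 2
      ≤ 64 * R ^ 2 + (1 + 2 * Real.log p.ε) ^ 4 / 4096 := by
    have e : 64 * R ^ 2 + (1 + 2 * Real.log p.ε) ^ 4 / 4096 - R / 4 * (1 + 2 * Real.log p.ε) ^ 2
        = (8 * R - (1 + 2 * Real.log p.ε) ^ 2 / 64) ^ 2 := by ring
    rw [← sub_nonneg, e]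
    exact sq_nonneg _
  linarith

/-- The sign of `log ε` decides. For `ε ≤ 1` the term `-log ε` in `A₃` helps, as its coefficient
exceeds the required one. For `ε > 1` it lowers `A₃`, and the loss is put into the factor of `A₄`.
-/
theorem le_bracket {T : ℕ} (hA₆ : 0 < p.A₆ T)
    (hA : 0 ≤ p.A₃ + 2 * p.A₅ * Real.log (p.A₆ T)) {Y g : ℝ} (hY : p.ε ≤ Y) (hg₀ : 0 ≤ g)
    (hg : g ≤ √(1 + p.ρ * p.L / p.ε) * (4 * p.fx₁ / p.η + 8 * (p.D₀ + (p.ρ * p.L) ^ 2) / p.ε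
      + 8 * p.D₁ * p.gx₁ ^ 2 / p.ε + 256 * p.D₁ ^ 2 * p.η ^ 2 * p.L ^ 2 / p.ε
      + 4 * p.L * p.η * Real.log (1 + p.ρ * p.L / p.ε)
      + (16 * (p.ρ * p.L) ^ 2 / p.ε + 4 * p.L * p.η) * Real.log (Y / p.ε))
      + 48 * √(1 + p.ρ * p.L / p.ε) * (p.ρ * p.L) ^ 2 / p.ε)
    (hYg : Y ≤ √(2 * p.D₀ * T + p.ε ^ 2) + 2 * p.D₁ * g)
    (hhalf : p.D₁ < 1 / 2 → Y = √(2 * p.D₀ * T + p.ε ^ 2)) :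
    g * Y ≤ p.bracket T ∨ p.D₁ < 1 / 2 ∧ Y ^ 2 ≤ p.bracket T := by
  have hε := h.ε_pos
  have hY0 := hε.trans_le hY
  have hκ := h.one_le_κ
  have hD := h.D₁_pos
  have hmain := h.le_mainPart
  have hκe : √(1 + p.ρ * p.L / p.ε) = p.κ := by rw [κ, add_comm]
  rw [hκe, Real.log_div hY0.ne' hε.ne'] at hg
  have hg' : g ≤ p.κ * p.mainPart + p.A₄
      + p.κ * (16 * (p.ρ * p.L) ^ 2 / p.ε + 4 * p.L * p.η) * (Real.log Y - Real.log p.ε) := by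
    linarith
  have h5 := h.le_A₅
  have hβ : 0 ≤ p.κ * (16 * (p.ρ * p.L) ^ 2 / p.ε + 4 * p.L * p.η) := by
    have := h.ρ_pos; have := h.L_nonneg; have := h.η_pos
    positivity
  have hA₃ := p.A₃_eq
  rcases le_or_gt p.ε 1 with hε1 | hε1
  · have hl := Real.log_nonpos hε.le hε1
    have hC := mul_le_mul_of_nonneg_left h.le_logPart (zero_le_one.trans hκ)
    have hCl : p.κ * (16 * (p.ρ * p.L) ^ 2 / p.ε + 4 * p.L * p.η) * -Real.log p.ε
        ≤ p.κ * p.logPart * -Real.log p.ε := mul_le_mul_of_nonneg_right hC (by linarith)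
    -- As `A₅ ≥ 8`, `A₆ < 1` forces `64 D₁ < 1` and `√(2D₀T + ε²) < 1/2`, so the summand 1 of the
    -- bracket suffices.
    rcases lt_or_ge (p.A₆ T) 1 with h61 | h61
    · right
      have hA₃0 : 0 ≤ p.A₃ := by
        have h1 := mul_nonneg (zero_le_one.trans hκ) h.mainPart_nonneg
        have h2 := mul_nonneg hβ (by linarith : 0 ≤ -Real.log p.ε)
        rw [hA₃]
        linarith
      have e : p.A₆ T = 2 * √(2 * p.D₀ * T + p.ε ^ 2) + 4 * p.D₁ * p.A₃
        + 8 * p.D₁ * p.A₅ * Real.log (4 * p.D₁ * p.A₅ + Real.exp 1) := rfl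
      have hA5 : 8 ≤ p.A₅ := by linarith [h.eight_mul_κ_le_A₅]
      have hDA : 0 ≤ p.D₁ * p.A₅ := mul_nonneg hD.le h.A₅_pos.le
      have h1 := one_le_log_add_exp (by linarith : 0 ≤ 4 * p.D₁ * p.A₅)
      have h2 := mul_le_mul_of_nonneg_left h1 hDA
      have h3 := mul_nonneg hD.le hA₃0
      have hX := Real.sqrt_nonneg (2 * p.D₀ * T + p.ε ^ 2)
      have hD64 : p.D₁ < 1 / 2 := by nlinarith
      refine ⟨hD64, le_trans ?_ (h.one_le_bracket hA₆ hA)⟩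
      rw [hhalf hD64] at hY0 ⊢
      exact pow_le_one₀ hX (by linarith)
    · left
      -- The positive part is needed to enlarge the coefficient of `log Y` to `2A₅`.
      refine h.mul_le_bracket_of_le hA₆ hA hY0 hg₀ (q := max (Real.log Y) 0) ?_ hYg ?_
      · have h1 := mul_le_mul_of_nonneg_left (le_max_left (Real.log Y) 0) hβ
        have h2 := mul_le_mul_of_nonneg_right h5 (le_max_right (Real.log Y) 0)
        rw [hA₃]
        linarith
      · rcases le_total (Real.log Y) 0 with hneg | hneg
        · exact Or.inr ⟨(max_eq_right hneg).le, h61⟩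
        · exact Or.inl (max_eq_left hneg).le
  · left
    have hl := Real.log_pos hε1
    have hYl : 0 ≤ Real.log Y - Real.log p.ε := sub_nonneg.2 (Real.log_le_log hε hY)
    have h1 := mul_le_mul_of_nonneg_right h5 hYl
    have hC := p.κ_mul_logPart h.η_pos
    have hCl : p.κ * p.logPart * Real.log p.ε
        = (2 * p.A₅ + 2 * p.A₄ - p.κ * (4 * p.η * p.L + 8)) * Real.log p.ε := by rw [hC]
    have hηL : 0 ≤ p.κ * (4 * p.η * p.L) * Real.log p.ε := by
      have := h.L_nonneg; have := h.η_pos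
      positivity
    have hgl : g ≤ p.A₃ + 2 * p.A₅ * Real.log Y + p.A₄ + (2 * p.A₄ - 8 * p.κ) * Real.log p.ε := by
      linarith
    -- The excess `(2A₄ - 8κ) log ε` is harmless if nonpositive; otherwise `A₄ > 4`, as
    -- `mul_le_bracket_of_le_log` requires.
    rcases le_or_gt p.A₄ (4 * p.κ) with h4 | h4
    · refine h.mul_le_bracket_of_le hA₆ hA hY0 hg₀ (q := Real.log Y) ?_ hYg (Or.inl le_rfl)
      have := mul_nonpos_of_nonpos_of_nonneg (by linarith : 2 * p.A₄ - 8 * p.κ ≤ 0) hl.le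
      linarith
    · refine h.mul_le_bracket_of_le_log hε1 (by linarith) hA₆ hA hY hg₀ ?_ hYg
      have := mul_nonneg (zero_le_one.trans hκ) hl.le
      linarith

end Valid

end Params

end LightSAM

/-! ### Assembly of the bound -/

namespace LightSAM

theorem sum_Icc_one_pred (f : ℕ → ℝ) (T : ℕ) :
    ∑ t ∈ Finset.Icc 1 T, f (t - 1) = ∑ t ∈ Finset.range T, f t := by
  induction T with
  | zero => simp
  | succ T ih =>
    rw [Finset.sum_Icc_succ_top (by omega), ih, Finset.sum_range_succ, Nat.add_sub_cancel]

theorem norm_perturb_sub_le {d : ℕ} {ρ u : ℝ} (hρ : 0 ≤ ρ) (hu : 0 ≤ u) (x s : Vec d) :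
    ‖perturb ρ u x s - x‖ ≤ ρ := by
  rw [norm_perturb_sub hρ]
  refine mul_le_of_le_one_right hρ (div_le_one_of_le₀ ?_ (Real.sqrt_nonneg _))
  exact Real.le_sqrt_of_sq_le (le_add_of_nonneg_left hu)

theorem params_valid {Ω : Type*} [MeasurableSpace Ω] (μ : Measure Ω) {d n b : ℕ} (hn : 0 < n)
    {ℓ : Fin n → Vec d → ℝ} (ξ : ℕ → Ω → (Fin b → Fin n)) {ρ η ε L D₀ D₁ : ℝ} (hρ : 0 < ρ)
    (hη : 0 < η) (hε : 0 < ε) (hL : 0 ≤ L) (hD₀ : 0 < D₀) (hD₁ : 0 < D₁) (x₁ : Vec d)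
    (hpos : ∀ x, 0 ≤ fullLoss ℓ x) (hsmooth : IsSmooth ℓ L) :
    (params μ ℓ ξ ρ η ε L D₀ D₁ x₁).Valid where
  ρ_pos := hρ
  η_pos := hη
  ε_pos := hε
  L_nonneg := hL
  D₀_pos := hD₀
  D₁_pos := hD₁
  fx₁_nonneg := hpos _
  gx₁_nonneg := norm_nonneg _
  gx₁_le := by
    simp only [params]
    set w := perturb ρ (ε ^ 2) x₁ (gradient (fullLoss ℓ) x₁)
    have h1 := norm_sub_norm_le (gradient (fullLoss ℓ) x₁) (gradient (fullLoss ℓ) w)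
    have h2 := lipschitz_gradient_fullLoss hn hsmooth x₁ w
    rw [norm_sub_rev x₁] at h2
    have h3 := mul_le_mul_of_nonneg_left
      (norm_perturb_sub_le hρ.le (sq_nonneg ε) x₁ (gradient (fullLoss ℓ) x₁)) hL
    linarith
  fw₁_nonneg := integral_nonneg fun _ => hpos _

end LightSAM

end

theorem theorem1 {Ω : Type*} [MeasurableSpace Ω] (μ : Measure Ω) [IsProbabilityMeasure μ]
    {d n b : ℕ} (hn : 0 < n) (hb : 0 < b)
    (ℓ : Fin n → LightSAM.Vec d → ℝ) (ξ : ℕ → Ω → (Fin b → Fin n))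
    (ρ η ε L D₀ D₁ : ℝ) (hρ : 0 < ρ) (hη : 0 < η) (hε : 0 < ε) (hL : 0 ≤ L)
    (hD₀ : 0 < D₀) (hD₁ : 0 < D₁) (x₁ : LightSAM.Vec d)
    (hpos : ∀ x, 0 ≤ LightSAM.fullLoss ℓ x)
    (hsample : LightSAM.IsMinibatchSampling μ ξ)
    (hsmooth : LightSAM.IsSmooth ℓ L)
    (hvar : LightSAM.AffineVariance μ ℓ ξ D₀ D₁)
    (T : ℕ)
    (p : LightSAM.Params) (hp : p = LightSAM.params μ ℓ ξ ρ η ε L D₀ D₁ x₁)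
    (hA₆ : 0 < p.A₆ T) (hA : 0 ≤ p.A₃ + 2 * p.A₅ * Real.log (p.A₆ T)) :
    (∀ t, Integrable (fun ω => ‖gradient (LightSAM.fullLoss ℓ)
        (LightSAM.iterate ℓ ρ η ε x₁ (fun k => ξ k ω) t)‖) μ) ∧
    ∑ t ∈ Finset.Icc 1 T, ∫ ω, ‖gradient (LightSAM.fullLoss ℓ)
        (LightSAM.iterate ℓ ρ η ε x₁ (fun k => ξ k ω) t)‖ ∂μ
      ≤ √(T : ℝ) * √(p.bracket T) := by
  have hint : ∀ t, Integrable (fun ω => ‖gradient (LightSAM.fullLoss ℓ)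
      (LightSAM.run ℓ ρ η ε x₁ (fun k => ξ k ω) t).x‖) μ := fun t =>
    hsample.integrable_run t fun s => ‖gradient (LightSAM.fullLoss ℓ) s.x‖
  refine ⟨fun t => hint (t - 1), ?_⟩
  simp only [LightSAM.iterate]
  rw [LightSAM.sum_Icc_one_pred fun t => ∫ ω, ‖gradient (LightSAM.fullLoss ℓ)
    (LightSAM.run ℓ ρ η ε x₁ (fun k => ξ k ω) t).x‖ ∂μ]
  rcases T.eq_zero_or_pos with rfl | hT
  · simp
  obtain ⟨ω₀⟩ : Nonempty Ω := nonempty_of_isProbabilityMeasure μ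
  have : Nonempty (Fin b → Fin n) := ⟨ξ 0 ω₀⟩
  have hm := hsample.measurable_batches T
  have : IsProbabilityMeasure (μ.map (LightSAM.batches ξ T)) :=
    Measure.isProbabilityMeasure_map hm.aemeasurable
  have hproc := hsample.randomTrajectory (x₁ := x₁) hn hb hρ hη hε hL hD₀ hD₁ hpos hsmooth hvar T
  obtain ⟨Y, g, hY, hg₀, hg, hYg, hW, hhalf⟩ := hproc.exists_bound hT
  have hsum : ∑ t ∈ Finset.range T, ∫ a, ‖gradient (LightSAM.fullLoss ℓ)
        (LightSAM.run ℓ ρ η ε x₁ (LightSAM.extend a) t).x‖ ∂(μ.map (LightSAM.batches ξ T))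
      = ∑ t ∈ Finset.range T, ∫ ω, ‖gradient (LightSAM.fullLoss ℓ)
        (LightSAM.run ℓ ρ η ε x₁ (fun k => ξ k ω) t).x‖ ∂μ := by
    refine Finset.sum_congr rfl fun t ht => ?_
    rw [LightSAM.integral_comp_of_finite hm]
    simp only [LightSAM.run_extend_batches (ξ := ξ) (Finset.mem_range.1 ht).le]
  rw [hsum] at hW hhalf
  have hvalid := LightSAM.params_valid μ hn ξ hρ hη hε hL hD₀ hD₁ x₁ hpos hsmooth
  rw [← hp] at hvalid
  have hp' := hvalid.le_bracket hA₆ hA (Y := Y) (g := g)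
  have e : p.ρ = ρ ∧ p.η = η ∧ p.ε = ε ∧ p.L = L ∧ p.D₀ = D₀ ∧ p.D₁ = D₁
      ∧ p.fx₁ = LightSAM.fullLoss ℓ x₁ ∧ p.gx₁ = ‖gradient (LightSAM.fullLoss ℓ) x₁‖ := by
    rw [hp]
    exact ⟨rfl, rfl, rfl, rfl, rfl, rfl, rfl, rfl⟩
  obtain ⟨e1, e2, e3, e4, e5, e6, e7, e8⟩ := e
  rw [e1, e2, e3, e4, e5, e6, e7, e8] at hp'
  have hfin : (∑ t ∈ Finset.range T, ∫ ω, ‖gradient (LightSAM.fullLoss ℓ)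
      (LightSAM.run ℓ ρ η ε x₁ (fun k => ξ k ω) t).x‖ ∂μ) ^ 2 ≤ T * p.bracket T := by
    rcases hp' hY hg₀ hg hYg (fun hlt => (hhalf hlt).1) with hle | ⟨hlt, hle⟩
    · exact hW.trans (mul_le_mul_of_nonneg_left hle T.cast_nonneg)
    · exact (hhalf hlt).2.trans (mul_le_mul_of_nonneg_left hle T.cast_nonneg)
  rw [← Real.sqrt_mul T.cast_nonneg]
  exact Real.le_sqrt_of_sq_le hfin
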